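/- **Setting.** An episodic layered MDP with horizon $H\ge 1$ has a finite state space split into layers $\mathcal S_0,\dots,\mathcal S_H$, all non-empty, with $\mathcal S_0=\{s_0\}$ and $\mathcal S_H=\{s_H\}$; the action space is $\mathcal A=[K]\times[K]$ for $K\ge 1$ arms, and the known transition kernel $P(\cdot\mid s,a)$ moves from $\mathcal S_h$ to $\mathcal S_{h+1}$. Let $\mathcal S$ be the set of non-terminal states and $S=|\mathcal S|$. A sequence of preference functions $\mathbf P_t:\mathcal S\times\mathcal A\to[0,1]$, $t=1,\dots,T$, with $\mathbf P_t(s,i,j)=1-\mathbf P_t(s,j,i)$, is fixed and unknown to the learner. In episode $t$ the learner executes a (possibly randomized, non-Markovian) policy $\pi_t$ from $s_0$, chosen from past observations, and at each visited pair $(s,(a^L,a^R))$ it observes only a feedback $o_t\sim\mathsf{Ber}(\mathbf P_t(s,a^L,a^R))$. The shifted Borda score and the loss are $b_t(s,i)=\frac1K\sum_{j}(\mathbf P_t(s,i,j)-1)$ and $\ell_t(s,a)=-\frac12(b_t(s,a^L)+b_t(s,a^R))$. With $V^\pi(s_0;\ell)$ the expected total loss of an episode under $\pi$ and $P$, the regret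 is $\mathsf{Reg}_T=\sum_{t=1}^T V^{\pi_t}(s_0;\ell_t)-\min_{\pi}\sum_{t=1}^T V^{\pi}(s_0;\ell_t)$, the minimum being over all stochastic Markov policies. Let $q^\pi(s,a)$ be the probability that an episode under $\pi$ visits $(s,a)$, $q(s)=\sum_a q(s,a)$, $\Omega$ the set of all $q^\pi$ with $\pi$ Markov, and for $q\in\Omega$ let $\pi^q$ be a Markov policy with $\pi^q(a\mid s)=q(s,a)/q(s)$ whenever $q(s)>0$. **Algorithm** (exploration rate $\gamma\in(0,1/2]$, learning rate $\eta>0$). For each $s$ let $r_s\in\arg\max_{q\in\Omega}q(s)$. In episode $t$ draw $\xi_t\sim\mathsf{Ber}(\gamma)$. * If $\xi_t=0$, execute $\pi^{\tilde q_t}$, where $\tilde q_t\in\arg\min_{q\in\Omega}\big\{\langle q,\sum_{\tau<t}\hat\ell_\tau\rangle-\frac1\eta\sum_{s,a}q(s,a)\log\frac1{q(s,a)}\big\}$. * If $\xi_t=1$, draw $\tilde s_t$ uniformly from $\mathcal S$, follow $\pi^{r_{\tilde s_t}}$ until $\tilde s_t$ is reached, play there two independent uniform arms, and follow an arbitrary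 policy afterwards. After the episode, with $\pi_t$ the policy executed given $(\xi_t,\tilde s_t)$, put $$\hat b_t(s,i)=\frac{\mathbb 1[a^L_{t,s}=i]}{K\sum_{j'}\pi_t((i,j')\mid s)}\cdot\frac{o_t(s,a^L_{t,s},a^R_{t,s})-1}{\sum_{i'}\pi_t((i',a^R_{t,s})\mid s)},\qquad \tilde b_t(s,i)=\frac{S}{\gamma\,q^{\pi_t}(s)}\,\mathbb 1[\xi_t=1,\tilde s_t=s,\ s\text{ visited}]\;\hat b_t(s,i),$$ and $\hat\ell_t(s,a)=-\frac12(\tilde b_t(s,a^L)+\tilde b_t(s,a^R))$, where $(a^L_{t,s},a^R_{t,s})$ is the arm pair chosen at $s$, and $\tilde b_t(s,i)=0$ whenever the indicator vanishes. **Theorem.** There is a universal constant $C>0$ such that for all $H,S,K,T$ with $T\ge 8S^2K\log(SK)/H^2$ there are $\gamma\in(0,1/2]$ and $\eta>0$, depending only on $H,S,K,T$, for which the algorithm satisfies $$\mathbb E[\mathsf{Reg}_T]\le C\,(H^2S^2K)^{1/3}\,T^{2/3}\,(\log(SK))^{1/3}$$ for every such MDP with horizon $H$, $S$ non-terminal states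 and $K$ arms, every preference sequence, and every choice of the maximizers, minimizers and arbitrary policies that the algorithm leaves open. -/

import Mathlib

universe u

namespace PbMDP

/-! ## Finite-support expectations and coins -/

/-- Expectation of `f` under `p`. Every law below has finite support, so the sum is finite. -/
noncomputable def expect {α : Type u} (p : PMF α) (f : α → ℝ) : ℝ :=
  ∑' x, (p x).toReal * f x

/-- The Bernoulli law with mean `p` (`true` is the outcome `1`). -/
noncomputable def coin (p : Set.Icc (0 : ℝ) 1) : PMF Bool :=
  PMF.ofFintype (fun b => ENNReal.ofReal (if b then (p : ℝ) else 1 - (p : ℝ))) (by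
    have h0 : (0 : ℝ) ≤ p := p.2.1
    have h1 : (0 : ℝ) ≤ 1 - (p : ℝ) := sub_nonneg.mpr p.2.2
    simp [← ENNReal.ofReal_add h0 h1])

/-! ## Layered tabular Markov decision processes with action space `[K] × [K]` -/

/-- An action is an ordered pair of arms (left arm, right arm). -/
abbrev ArmPair (K : ℕ) : Type := Fin K × Fin K

/-- A layered episodic MDP with horizon `H`: the states are split into the layers `0, …, H`, the
first and the last layer are singletons, all layers are non-empty, and every transition moves one
layer forward. -/
structure LayeredMDP (State : Type u) (K H : ℕ) where
  /-- there is at least one step per episode -/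
  horizon_pos : 0 < H
  /-- the layer of a state -/
  layer : State → ℕ
  /-- the initial state -/
  init : State
  /-- the terminal state -/
  terminal : State
  layer_le : ∀ s, layer s ≤ H
  layer_eq_zero_iff : ∀ s, layer s = 0 ↔ s = init
  layer_eq_horizon_iff : ∀ s, layer s = H ↔ s = terminal
  layer_nonempty : ∀ h, h ≤ H → ∃ s, layer s = h
  /-- the transition kernel (its value at the terminal state is never used) -/
  trans : State → ArmPair K → PMF State
  layer_trans : ∀ s a s', layer s < H → s' ∈ (trans s a).support → layer s' = layer s + 1

/-- Stochastic Markov policies. -/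
abbrev Policy (State : Type u) (K : ℕ) : Type u := State → PMF (ArmPair K)

/-- Possibly non-Markovian policies: the law of the next action depends on the state-action pairs
of the earlier steps of the episode (most recent first) and on the current state. -/
abbrev HistPolicy (State : Type u) (K : ℕ) : Type u :=
  List (State × ArmPair K) → State → PMF (ArmPair K)

/-- A Markov policy as a policy that ignores the past of the episode. -/
def Policy.toHist {State : Type u} {K : ℕ} (π : Policy State K) : HistPolicy State K :=
  fun _ s => π s

namespace LayeredMDP

variable {State : Type u} {K H : ℕ} (M : LayeredMDP State K H)

/-- Play `n` more steps with `π` from the state `s`, the earlier state-action pairs being `past`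
(most recent first); the outcome is the list of all state-action pairs (most recent first). -/
noncomputable def rollout (π : HistPolicy State K) :
    ℕ → List (State × ArmPair K) → State → PMF (List (State × ArmPair K))
  | 0, past, _ => PMF.pure past
  | n + 1, past, s =>
      (π past s).bind fun a => (M.trans s a).bind fun s' => rollout π n ((s, a) :: past) s'

/-- The law of the list of state-action pairs `(s_h, a_h)`, `h = h(s), …, H - 1` (most recent
first), when `π` is executed from the state `s`. -/
noncomputable def pathLaw (π : HistPolicy State K) (s : State) :
    PMF (List (State × ArmPair K)) :=
  M.rollout π (H - M.layer s) [] s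

/-- The value function `V^π(s; ℓ)`. -/
noncomputable def value (π : HistPolicy State K) (s : State) (loss : State → ArmPair K → ℝ) : ℝ :=
  expect (M.pathLaw π s) fun path => (path.map fun x => loss x.1 x.2).sum

/-- The occupancy measure `q^π(s, a)`: the probability that `(s, a)` is visited in an episode. -/
noncomputable def occ [DecidableEq State] (π : HistPolicy State K) (s : State) (a : ArmPair K) :
    ℝ :=
  expect (M.pathLaw π M.init) fun path => if (s, a) ∈ path then 1 else 0

/-- The set `Ω` of the occupancy measures of all Markov policies. -/
def occSet [DecidableEq State] : Set (State → ArmPair K → ℝ) :=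
  {q | ∃ π : Policy State K, q = M.occ π.toHist}

/-- The non-terminal states, i.e. the states at which actions are taken. -/
def activeStates [Fintype State] : Finset State :=
  Finset.univ.filter fun s => M.layer s < H

/-- The number `S` of non-terminal states. -/
def numStates [Fintype State] : ℕ := M.activeStates.card

theorem activeStates_nonempty [Fintype State] : M.activeStates.Nonempty :=
  ⟨M.init, by
    simp [activeStates, (M.layer_eq_zero_iff M.init).mpr rfl, M.horizon_pos]⟩

end LayeredMDP

/-- The state marginal `q(s) = ∑ a, q(s, a)`. -/
def stateMass {State : Type u} {K : ℕ} (q : State → ArmPair K → ℝ) (s : State) : ℝ :=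
  ∑ a, q s a

/-- `π` is a Markov policy induced by `q`: `π(a | s) = q(s, a) / q(s)` wherever `q(s) > 0`
(and it is arbitrary elsewhere). -/
def IsInducedBy {State : Type u} {K : ℕ} (π : Policy State K) (q : State → ArmPair K → ℝ) : Prop :=
  ∀ s, 0 < stateMass q s → ∀ a, (π s a).toReal = q s a / stateMass q s

/-! ## Preferences and Borda scores -/

/-- A preference function with values in `[0, 1]` and `P(s, (i, j)) = 1 - P(s, (j, i))`. -/
structure Preference (State : Type u) (K : ℕ) where
  prob : State → ArmPair K → Set.Icc (0 : ℝ) 1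
  antisymm : ∀ s i j, (prob s (i, j) : ℝ) = 1 - prob s (j, i)

namespace Preference

variable {State : Type u} {K : ℕ} (p : Preference State K)

/-- The shifted Borda score `b(s, i) = (1 / K) ∑ j, (P(s, i, j) - 1)`. -/
noncomputable def borda (s : State) (i : Fin K) : ℝ :=
  (1 / (K : ℝ)) * ∑ j, ((p.prob s (i, j) : ℝ) - 1)

/-- The Borda loss `ℓ(s, a) = -(b(s, a^L) + b(s, a^R)) / 2`. -/
noncomputable def loss (s : State) (a : ArmPair K) : ℝ :=
  -(1 / 2) * (p.borda s a.1 + p.borda s a.2)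

/-- Each visited state-action pair independently receives a preference feedback, drawn from the
Bernoulli law with mean `P(s, a)`. -/
noncomputable def feedbackLaw :
    List (State × ArmPair K) → PMF (List (State × ArmPair K × Bool))
  | [] => PMF.pure []
  | x :: path => (coin (p.prob x.1 x.2)).bind fun o =>
      (feedbackLaw path).map fun rest => (x.1, x.2, o) :: rest

end Preference

/-! ## The global-optimization algorithm -/

/-- The record of one episode: the learner's draw (`none` for `ξ = 0`, and `some s` for `ξ = 1`
with the sampled target state `s`), and the visited states, chosen arm pairs and observed
preference feedbacks (most recent first). -/
structure Episode (State : Type u) (K : ℕ) where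
  draw : Option State
  steps : List (State × ArmPair K × Bool)

/-- The objects that the pseudocode computes by an `argmin` or `argmax` or leaves arbitrary. The
lists of episodes are the past episodes (most recent first). -/
structure Choices (State : Type u) (K : ℕ) where
  /-- `r_s`, an occupancy measure that maximizes the probability of reaching `s` -/
  reachOcc : State → State → ArmPair K → ℝ
  /-- `π^{r_s}` -/
  reachPolicy : State → Policy State K
  /-- the output of follow-the-regularized-leader -/
  ftrlOcc : List (Episode State K) → State → ArmPair K → ℝ
  /-- the policy induced by the output of follow-the-regularized-leader -/
  ftrlPolicy : List (Episode State K) → Policy State K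
  /-- the arbitrary policy used after the target state of an exploration episode -/
  afterTarget : List (Episode State K) → State → HistPolicy State K

/-- The uniform law on pairs of arms, i.e. two independent uniform arms. -/
noncomputable def uniformArms (K : ℕ) [NeZero K] : PMF (ArmPair K) :=
  PMF.uniformOfFintype (ArmPair K)

section Algorithm

variable {State : Type u} [Fintype State] [DecidableEq State] {K H : ℕ} [NeZero K]

/-- The policy executed in an episode, given the past episodes and the draw. After the draw `some g`
the learner follows `π^{r_g}` until `g` is reached, plays two independent uniform arms at `g`, and
then follows the arbitrary policy. -/
noncomputable def Choices.executed (c : Choices State K) (past : List (Episode State K)) :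
    Option State → HistPolicy State K
  | none => (c.ftrlPolicy past).toHist
  | some g => fun earlier s =>
      if g ∈ earlier.map Prod.fst then c.afterTarget past g earlier s
      else if s = g then uniformArms K
      else c.reachPolicy g s

/-- The law of the draw: `ξ ∼ Ber(γ)`, and a uniform non-terminal state if `ξ = 1`. -/
noncomputable def drawLaw (M : LayeredMDP State K H) (γ : Set.Ioc (0 : ℝ) (1 / 2)) :
    PMF (Option State) :=
  (coin ⟨γ, γ.2.1.le, γ.2.2.trans (by norm_num)⟩).bind fun ξ =>
    if ξ then (PMF.uniformOfFinset M.activeStates M.activeStates_nonempty).map some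
    else PMF.pure none

/-- The conditional law of an episode with preference function `p`, given the past episodes. -/
noncomputable def episodeLaw (M : LayeredMDP State K H) (γ : Set.Ioc (0 : ℝ) (1 / 2))
    (c : Choices State K) (p : Preference State K) (past : List (Episode State K)) :
    PMF (Episode State K) :=
  (drawLaw M γ).bind fun d =>
    (M.pathLaw (c.executed past d) M.init).bind fun path =>
      (p.feedbackLaw path).map fun steps => ⟨d, steps⟩

/-- The law of the first `n` episodes (most recent first); the episode with `t` predecessors uses
the preference function `pref t`. -/
noncomputable def runLaw (M : LayeredMDP State K H) (γ : Set.Ioc (0 : ℝ) (1 / 2))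
    (c : Choices State K) (pref : ℕ → Preference State K) : ℕ → PMF (List (Episode State K))
  | 0 => PMF.pure []
  | n + 1 => (runLaw M γ c pref n).bind fun past =>
      (episodeLaw M γ c (pref n) past).map fun e => e :: past

/-- The probability `π(a | s) = q^π(s, a) / q^π(s)` that a policy plays `a` when it is at `s`. -/
noncomputable def condAction (M : LayeredMDP State K H) (π : HistPolicy State K) (s : State)
    (a : ArmPair K) : ℝ :=
  M.occ π s a / stateMass (M.occ π) s

/-- The importance-weighted Borda estimator `b̂(s, i)` of an episode in which `π` was executed; it is
`0` if `s` was not visited, and a sum with a single term otherwise, since a state is visited at most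
once per episode. -/
noncomputable def bHat (M : LayeredMDP State K H) (π : HistPolicy State K)
    (steps : List (State × ArmPair K × Bool)) (s : State) (i : Fin K) : ℝ :=
  ((steps.filter fun x => x.1 = s).map fun x =>
    (if x.2.1.1 = i then (1 : ℝ) else 0) / ((K : ℝ) * ∑ j, condAction M π s (i, j)) *
      (((if x.2.2 then (1 : ℝ) else 0) - 1) / ∑ i', condAction M π s (i', x.2.1.2))).sum

/-- The estimator `b̃(s, i) = S / (γ q^{π_t}(s)) · 1[ξ_t = 1, target = s] · 1[s visited] · b̂(s, i)`
computed at the end of the episode `e` that follows the episodes `past`. -/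
noncomputable def bTilde (M : LayeredMDP State K H) (γ : Set.Ioc (0 : ℝ) (1 / 2))
    (c : Choices State K) (past : List (Episode State K)) (e : Episode State K)
    (s : State) (i : Fin K) : ℝ :=
  (M.numStates : ℝ) / ((γ : ℝ) * stateMass (M.occ (c.executed past e.draw)) s) *
    (if e.draw = some s then 1 else 0) *
    (if s ∈ e.steps.map Prod.fst then 1 else 0) *
    bHat M (c.executed past e.draw) e.steps s i

/-- The loss estimator `ℓ̂(s, a) = -(b̃(s, a^L) + b̃(s, a^R)) / 2`. -/
noncomputable def lossHat (M : LayeredMDP State K H) (γ : Set.Ioc (0 : ℝ) (1 / 2))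
    (c : Choices State K) (past : List (Episode State K)) (e : Episode State K)
    (s : State) (a : ArmPair K) : ℝ :=
  -(1 / 2) * (bTilde M γ c past e s a.1 + bTilde M γ c past e s a.2)

/-- The sum of the loss estimators of all past episodes. -/
noncomputable def cumLossHat (M : LayeredMDP State K H) (γ : Set.Ioc (0 : ℝ) (1 / 2))
    (c : Choices State K) : List (Episode State K) → State → ArmPair K → ℝ
  | [], _, _ => 0
  | e :: past, s, a => cumLossHat M γ c past s a + lossHat M γ c past e s a

/-- The Shannon entropy `∑ q(s, a) log (1 / q(s, a))`, with `0 log (1 / 0) = 0`. -/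
noncomputable def entropy (q : State → ArmPair K → ℝ) : ℝ :=
  ∑ s, ∑ a, q s a * Real.log (1 / q s a)

/-- The FTRL objective `⟨q, ∑ τ, ℓ̂_τ⟩ - (1 / η) · entropy q`. -/
noncomputable def ftrlObjective (M : LayeredMDP State K H) (γ : Set.Ioc (0 : ℝ) (1 / 2)) (η : ℝ)
    (c : Choices State K) (past : List (Episode State K)) (q : State → ArmPair K → ℝ) : ℝ :=
  (∑ s, ∑ a, q s a * cumLossHat M γ c past s a) - 1 / η * entropy q

/-- The choices are those prescribed by the algorithm with exploration rate `γ` and learning rate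
`η`; ties and the policies at states of occupancy zero are arbitrary. -/
structure Choices.IsImplementation (c : Choices State K) (M : LayeredMDP State K H)
    (γ : Set.Ioc (0 : ℝ) (1 / 2)) (η : ℝ) : Prop where
  reachOcc_mem : ∀ s, c.reachOcc s ∈ M.occSet
  reachOcc_max : ∀ s, ∀ q ∈ M.occSet, stateMass q s ≤ stateMass (c.reachOcc s) s
  reachPolicy_induced : ∀ s, IsInducedBy (c.reachPolicy s) (c.reachOcc s)
  ftrlOcc_mem : ∀ past, c.ftrlOcc past ∈ M.occSet
  ftrlOcc_min : ∀ past, ∀ q ∈ M.occSet,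
    ftrlObjective M γ η c past (c.ftrlOcc past) ≤ ftrlObjective M γ η c past q
  ftrlPolicy_induced : ∀ past, IsInducedBy (c.ftrlPolicy past) (c.ftrlOcc past)

/-! ## Regret -/

/-- The learner's cumulative value `∑ t, V^{π_t}(s_0; ℓ_t)` in a run, where `π_t` is the policy
executed in the episode `t`. -/
noncomputable def learnerValue (M : LayeredMDP State K H) (c : Choices State K)
    (pref : ℕ → Preference State K) : List (Episode State K) → ℝ
  | [] => 0
  | e :: past => learnerValue M c pref past +
      M.value (c.executed past e.draw) M.init (pref past.length).loss

/-- The regret `∑ t, V^{π_t}(s_0; ℓ_t) - min_π ∑ t, V^π(s_0; ℓ_t)` of a run of `T` episodes, where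
the minimum is over all Markov policies. -/
noncomputable def regret (M : LayeredMDP State K H) (c : Choices State K)
    (pref : ℕ → Preference State K) (T : ℕ) (run : List (Episode State K)) : ℝ :=
  learnerValue M c pref run -
    ⨅ π : Policy State K, ∑ t ∈ Finset.range T, M.value π.toHist M.init (pref t).loss

/-- The expected regret of `T` episodes of the algorithm. -/
noncomputable def expectedRegret (M : LayeredMDP State K H) (γ : Set.Ioc (0 : ℝ) (1 / 2))
    (c : Choices State K) (pref : ℕ → Preference State K) (T : ℕ) : ℝ :=
  expect (runLaw M γ c pref T) (regret M c pref T)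

end Algorithm

end PbMDP

namespace PbMDP

/-! ## Expectations under laws of finite support -/

section Expectation

variable {α : Type u} {p : PMF α}

/-! The value of a policy is linear in its occupancy measure (`value_eq_sum_occ`), and the occupancy
measures of Markov policies are exactly the solutions of the flow equations (`occ_isFlow`,
`IsFlow.mem_occSet`), a convex set. Regret minimization thus becomes online linear optimization over
`Ω` with estimated losses.

Let `m_s` be the largest probability of reaching `s`. An exploration episode with target `s` reaches
it with probability `m_s` and plays uniform arms there, so the importance weights are explicit. The
estimator is unbiased at reachable states, with second moment at most `SK / (γ m_s)`
(`expect_lossHat`, `expect_lossHat_sq_le`). Every `q ∈ Ω` has `q(s) ≤ m_s`, so in the local norm `∑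
q ℓ̂²` the factor `1 / m_s` cancels and `S²K / γ` remains (`expect_inner_lossHat_sq_le`). No lower
bound on reachability is needed.

For the entropic leader, the minimum of the regularized objective grows per episode by at least the
leader's estimated loss minus `η / 2` times the local norm (`regularized_min_step`). The shift of
the Borda score makes the estimated losses nonnegative, so `η ℓ̂` need not be small. Exploration
costs at most `γ H` per episode. Telescoping (`expect_potential_le`) bounds the regret by `2 H
log(SK) / η + T (γ H + η S²K / (2γ))`, and tuning `γ` and `η` equalizes the three terms. -/

theorem expect_eq_sum_of_support_subset {U : Finset α} (hU : p.support ⊆ U) (f : α → ℝ) :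
    expect p f = ∑ x ∈ U, (p x).toReal * f x := by
  refine tsum_eq_sum fun x hx => ?_
  have : p x = 0 := by
    by_contra h
    exact hx (hU ((PMF.mem_support_iff p x).mpr h))
  simp [this]

theorem expect_eq_sum_support (hp : p.support.Finite) (f : α → ℝ) :
    expect p f = ∑ x ∈ hp.toFinset, (p x).toReal * f x :=
  expect_eq_sum_of_support_subset (by simp) f

theorem expect_eq_sum_univ [Fintype α] (p : PMF α) (f : α → ℝ) :
    expect p f = ∑ x, (p x).toReal * f x :=
  expect_eq_sum_of_support_subset (by simp) f

theorem sum_toReal_eq_one (hp : p.support.Finite) :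
    ∑ x ∈ hp.toFinset, (p x).toReal = 1 := by
  rw [← ENNReal.toReal_sum fun x _ => p.apply_ne_top x]
  have h : ∑' x, p x = ∑ x ∈ hp.toFinset, p x :=
    tsum_eq_sum fun x hx => by simpa [PMF.mem_support_iff] using hx
  rw [← h, p.tsum_coe, ENNReal.toReal_one]

theorem sum_univ_toReal [Fintype α] (p : PMF α) : ∑ x, (p x).toReal = 1 := by
  rw [← ENNReal.toReal_sum fun x _ => p.apply_ne_top x, ← tsum_fintype (L := .unconditional _),
    p.tsum_coe, ENNReal.toReal_one]

theorem expect_const (hp : p.support.Finite) (c : ℝ) : expect p (fun _ => c) = c := by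
  rw [expect_eq_sum_support hp, ← Finset.sum_mul, sum_toReal_eq_one hp, one_mul]

theorem expect_mono (hp : p.support.Finite) {f g : α → ℝ} (h : ∀ x ∈ p.support, f x ≤ g x) :
    expect p f ≤ expect p g := by
  rw [expect_eq_sum_support hp, expect_eq_sum_support hp]
  refine Finset.sum_le_sum fun x hx => ?_
  exact mul_le_mul_of_nonneg_left (h x (by simpa using hx)) ENNReal.toReal_nonneg

theorem expect_congr {f g : α → ℝ} (h : ∀ x ∈ p.support, f x = g x) :
    expect p f = expect p g := by
  refine tsum_congr fun x => ?_
  by_cases hx : p x = 0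
  · simp [hx]
  · rw [h x ((PMF.mem_support_iff p x).mpr hx)]

theorem expect_add (hp : p.support.Finite) (f g : α → ℝ) :
    expect p (fun x => f x + g x) = expect p f + expect p g := by
  simp only [expect_eq_sum_support hp, mul_add, Finset.sum_add_distrib]

theorem expect_sub (hp : p.support.Finite) (f g : α → ℝ) :
    expect p (fun x => f x - g x) = expect p f - expect p g := by
  simp only [expect_eq_sum_support hp, mul_sub, Finset.sum_sub_distrib]

theorem expect_const_mul (hp : p.support.Finite) (c : ℝ) (f : α → ℝ) :
    expect p (fun x => c * f x) = c * expect p f := by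
  simp only [expect_eq_sum_support hp, Finset.mul_sum, mul_left_comm]

theorem expect_finset_sum {ι : Type*} (hp : p.support.Finite) (t : Finset ι) (f : ι → α → ℝ) :
    expect p (fun x => ∑ i ∈ t, f i x) = ∑ i ∈ t, expect p (f i) := by
  simp only [expect_eq_sum_support hp, Finset.mul_sum]
  exact Finset.sum_comm

theorem expect_pure (x : α) (f : α → ℝ) : expect (PMF.pure x) f = f x := by
  rw [expect_eq_sum_of_support_subset (U := {x}) (by simp)]
  simp

end Expectation

/-! ### Expectations under composed laws. -/

section Bind

universe v
variable {α : Type u} {β : Type v}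

theorem finite_support_bind {p : PMF α} {f : α → PMF β} (hp : p.support.Finite)
    (hf : ∀ x, (f x).support.Finite) : (p.bind f).support.Finite := by
  rw [PMF.support_bind]
  exact hp.biUnion fun x _ => hf x

theorem finite_support_map {p : PMF α} (hp : p.support.Finite) (f : α → β) :
    (p.map f).support.Finite := by
  rw [PMF.support_map]
  exact hp.image f

theorem expect_bind {p : PMF α} {f : α → PMF β} (hp : p.support.Finite)
    (hf : ∀ x, (f x).support.Finite) (g : β → ℝ) :
    expect (p.bind f) g = expect p fun x => expect (f x) g := by
  have hb := finite_support_bind hp hf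
  have hx : ∀ x ∈ hp.toFinset, expect (f x) g = ∑ y ∈ hb.toFinset, (f x y).toReal * g y := by
    intro x hx
    refine expect_eq_sum_of_support_subset ?_ g
    intro y hy
    simp only [Set.Finite.coe_toFinset, PMF.support_bind, Set.mem_iUnion]
    exact ⟨x, by simpa using hx, hy⟩
  rw [expect_eq_sum_support hp, Finset.sum_congr rfl fun x h => congrArg _ (hx x h),
    expect_eq_sum_support hb]
  simp only [Finset.mul_sum]
  rw [Finset.sum_comm]
  refine Finset.sum_congr rfl fun y _ => ?_
  have h : (p.bind f) y = ∑ x ∈ hp.toFinset, p x * f x y := by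
    rw [PMF.bind_apply]
    refine tsum_eq_sum fun x hx => ?_
    have : p x = 0 := by simpa [PMF.mem_support_iff] using hx
    simp [this]
  rw [h, ENNReal.toReal_sum fun x _ => ENNReal.mul_ne_top (p.apply_ne_top x) ((f x).apply_ne_top y),
    Finset.sum_mul]
  exact Finset.sum_congr rfl fun x _ => by rw [ENNReal.toReal_mul]; ring

theorem expect_map {p : PMF α} (hp : p.support.Finite) (f : α → β) (g : β → ℝ) :
    expect (p.map f) g = expect p fun x => g (f x) := by
  rw [← PMF.bind_pure_comp, expect_bind hp (by simp)]
  exact expect_congr fun x _ => expect_pure _ _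

end Bind

theorem expect_coin (p : Set.Icc (0 : ℝ) 1) (f : Bool → ℝ) :
    expect (coin p) f = p * f true + (1 - p) * f false := by
  have h0 : (0 : ℝ) ≤ p := p.2.1
  have h1 : (0 : ℝ) ≤ 1 - (p : ℝ) := sub_nonneg.mpr p.2.2
  rw [expect_eq_sum_univ]
  simp [coin, ENNReal.toReal_ofReal, h0, p.2.2]


/-! ## Paths and occupancy measures -/

namespace LayeredMDP

variable {State : Type u} {K H : ℕ} (M : LayeredMDP State K H)

theorem layer_init : M.layer M.init = 0 := (M.layer_eq_zero_iff _).mpr rfl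

theorem layer_lt_of_mem_support {s s' : State} {a : ArmPair K} {n : ℕ} (hn : n + 1 + M.layer s ≤ H)
    (h : s' ∈ (M.trans s a).support) : M.layer s' = M.layer s + 1 :=
  M.layer_trans s a s' (by omega) h

/-- Along a path, the layers strictly increase. -/
theorem pairwise_layer_of_mem_rollout (π : HistPolicy State K) (n : ℕ) :
    ∀ (past : List (State × ArmPair K)) (s : State), n + M.layer s ≤ H →
      past.Pairwise (fun x y => M.layer y.1 < M.layer x.1) →
      (∀ x ∈ past, M.layer x.1 < M.layer s) →
      ∀ path ∈ (M.rollout π n past s).support,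
        path.Pairwise fun x y => M.layer y.1 < M.layer x.1 := by
  induction n with
  | zero =>
    intro past s _ hp _ path hpath
    simp only [rollout, PMF.support_pure, Set.mem_singleton_iff] at hpath
    exact hpath ▸ hp
  | succ n ih =>
    intro past s hn hp hs path hpath
    simp only [rollout, PMF.mem_support_bind_iff] at hpath
    obtain ⟨a, _, s', hs', hpath⟩ := hpath
    have hl := M.layer_lt_of_mem_support hn hs'
    refine ih ((s, a) :: past) s' (by omega) (List.pairwise_cons.mpr ⟨hs, hp⟩) ?_ path hpath
    intro x hx
    rcases List.mem_cons.mp hx with rfl | hx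
    · simp [hl]
    · have := hs x hx
      omega

theorem pairwise_layer_of_mem_pathLaw (π : HistPolicy State K) {path : List (State × ArmPair K)}
    (h : path ∈ (M.pathLaw π M.init).support) :
    path.Pairwise fun x y => M.layer y.1 < M.layer x.1 :=
  M.pairwise_layer_of_mem_rollout π _ [] _ (by rw [layer_init]; simp) List.Pairwise.nil (by simp)
    path h

theorem nodup_of_mem_pathLaw (π : HistPolicy State K) {path : List (State × ArmPair K)}
    (h : path ∈ (M.pathLaw π M.init).support) : path.Nodup :=
  (M.pairwise_layer_of_mem_pathLaw π h).imp fun hxy he => by simp [he] at hxy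

section Fintype

variable [Fintype State]

theorem rollout_support_finite (π : HistPolicy State K) (n : ℕ) :
    ∀ (past : List (State × ArmPair K)) (s : State), (M.rollout π n past s).support.Finite := by
  induction n with
  | zero => intro past s; simp [rollout]
  | succ n ih =>
    intro past s
    exact finite_support_bind (Set.toFinite _) fun a =>
      finite_support_bind (Set.toFinite _) fun s' => ih _ _

theorem pathLaw_support_finite (π : HistPolicy State K) (s : State) :
    (M.pathLaw π s).support.Finite := M.rollout_support_finite π _ _ _

/-- The expected sum of `f` over the next `n` steps. -/
noncomputable def futureSum (π : HistPolicy State K) (f : State → ArmPair K → ℝ) :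
    ℕ → List (State × ArmPair K) → State → ℝ
  | 0, _, _ => 0
  | n + 1, past, s => ∑ a, (π past s a).toReal *
      (f s a + ∑ s', (M.trans s a s').toReal * futureSum π f n ((s, a) :: past) s')

theorem expect_rollout_sum (π : HistPolicy State K) (f : State → ArmPair K → ℝ) (n : ℕ) :
    ∀ (past : List (State × ArmPair K)) (s : State),
      expect (M.rollout π n past s) (fun path => (path.map fun x => f x.1 x.2).sum) =
        (past.map fun x => f x.1 x.2).sum + M.futureSum π f n past s := by
  induction n with
  | zero => intro past s; simp [rollout, futureSum, expect_pure]
  | succ n ih =>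
    intro past s
    rw [rollout, expect_bind (Set.toFinite _) fun a =>
      finite_support_bind (Set.toFinite _) fun s' => M.rollout_support_finite π _ _ _]
    have h : ∀ a, expect ((M.trans s a).bind fun s' => M.rollout π n ((s, a) :: past) s')
        (fun path => (path.map fun x => f x.1 x.2).sum) =
        (past.map fun x => f x.1 x.2).sum + (f s a +
          ∑ s', (M.trans s a s').toReal * M.futureSum π f n ((s, a) :: past) s') := by
      intro a
      rw [expect_bind (Set.toFinite _) fun s' => M.rollout_support_finite π _ _ _,
        expect_congr fun s' _ => ih _ s', expect_add (Set.toFinite _),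
        expect_const (Set.toFinite _), expect_eq_sum_univ, List.map_cons, List.sum_cons]
      ring
    rw [expect_congr fun a _ => h a, expect_add (Set.toFinite _), expect_const (Set.toFinite _),
      expect_eq_sum_univ, futureSum]

theorem value_eq_futureSum (π : HistPolicy State K) (f : State → ArmPair K → ℝ) :
    M.value π M.init f = M.futureSum π f H [] M.init := by
  rw [value, pathLaw, M.expect_rollout_sum, layer_init]
  simp

variable [DecidableEq State]

/-- Layers strictly increase along a path, so no pair is visited twice and the loss of a path is a
sum of visit indicators. -/
theorem value_eq_sum_occ (π : HistPolicy State K) (f : State → ArmPair K → ℝ) :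
    M.value π M.init f = ∑ s, ∑ a, M.occ π s a * f s a := by
  have hfin := M.pathLaw_support_finite π M.init
  have h : ∀ path ∈ (M.pathLaw π M.init).support, (path.map fun x => f x.1 x.2).sum =
      ∑ s, ∑ a, f s a * (if (s, a) ∈ path then 1 else 0) := by
    intro path hpath
    rw [← List.sum_toFinset _ (M.nodup_of_mem_pathLaw π hpath), ← Fintype.sum_prod_type'
      (f := fun s a => f s a * (if (s, a) ∈ path then 1 else 0))]
    simp [← List.mem_toFinset]
  rw [value, expect_congr h, expect_finset_sum hfin]
  refine Finset.sum_congr rfl fun s _ => ?_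
  rw [expect_finset_sum hfin]
  refine Finset.sum_congr rfl fun a _ => ?_
  rw [expect_const_mul hfin, occ, mul_comm]

/-- This opens occupancy measures to induction on the number of remaining steps. -/
theorem occ_eq_futureSum (π : HistPolicy State K) (s : State) (a : ArmPair K) :
    M.occ π s a =
      M.futureSum π (fun s' a' => if s' = s ∧ a' = a then 1 else 0) H [] M.init := by
  rw [← value_eq_futureSum, value_eq_sum_occ]
  simp [ite_and, Finset.sum_ite_eq']

theorem occ_nonneg (π : HistPolicy State K) (s : State) (a : ArmPair K) : 0 ≤ M.occ π s a := by
  have hfin := M.pathLaw_support_finite π M.init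
  rw [← expect_const hfin 0]
  exact expect_mono hfin fun path _ => by split_ifs <;> simp

theorem occ_le_one (π : HistPolicy State K) (s : State) (a : ArmPair K) : M.occ π s a ≤ 1 := by
  have hfin := M.pathLaw_support_finite π M.init
  rw [← expect_const hfin 1]
  exact expect_mono hfin fun path _ => by split_ifs <;> simp

omit [DecidableEq State] in
-- The kernel charges only the next layer. The hypothesis `hn` excludes the terminal state, where
-- the kernel is unconstrained.
theorem sum_trans_toReal_mul_congr {s : State} {a : ArmPair K} {n : ℕ} (hn : n + 1 + M.layer s ≤ H)
    {f g : State → ℝ} (h : ∀ s', M.layer s' = M.layer s + 1 → f s' = g s') :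
    ∑ s', (M.trans s a s').toReal * f s' = ∑ s', (M.trans s a s').toReal * g s' := by
  rw [← expect_eq_sum_univ, ← expect_eq_sum_univ]
  exact expect_congr fun s' hs' => h s' (M.layer_lt_of_mem_support hn hs')

omit [DecidableEq State] in
theorem futureSum_eq_zero_of_layer_lt (π : HistPolicy State K) {f : State → ArmPair K → ℝ}
    {g : State} (hf : ∀ s a, s ≠ g → f s a = 0) (n : ℕ) :
    ∀ (past : List (State × ArmPair K)) (s : State), n + M.layer s ≤ H → M.layer g < M.layer s →
      M.futureSum π f n past s = 0 := by
  induction n with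
  | zero => intro past s _ _; rfl
  | succ n ih =>
    intro past s hn hs
    have hsg : s ≠ g := by rintro rfl; exact lt_irrefl _ hs
    refine Finset.sum_eq_zero fun a _ => ?_
    rw [hf s a hsg, M.sum_trans_toReal_mul_congr hn (g := fun _ => 0) fun s' hs' =>
      ih _ s' (by omega) (by omega)]
    simp

omit [DecidableEq State] in
theorem futureSum_const (π : HistPolicy State K) (c : ℝ) (n : ℕ) :
    ∀ (past : List (State × ArmPair K)) (s : State),
      M.futureSum π (fun _ _ => c) n past s = n * c := by
  induction n with
  | zero => intro past s; simp [futureSum]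
  | succ n ih =>
    intro past s
    simp only [futureSum, ih, ← Finset.sum_mul, sum_univ_toReal]
    push_cast
    ring

omit [DecidableEq State] in
theorem futureSum_mono (π : HistPolicy State K) {f g : State → ArmPair K → ℝ}
    (h : ∀ s a, f s a ≤ g s a) (n : ℕ) :
    ∀ (past : List (State × ArmPair K)) (s : State),
      M.futureSum π f n past s ≤ M.futureSum π g n past s := by
  induction n with
  | zero => intro past s; rfl
  | succ n ih =>
    intro past s
    simp only [futureSum]
    gcongr with a _ s' _
    · exact h s a
    · exact ih _ _

theorem sum_occ (π : HistPolicy State K) : ∑ s, ∑ a, M.occ π s a = H := by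
  have h := M.value_eq_sum_occ π fun _ _ => 1
  rw [value_eq_futureSum, futureSum_const] at h
  simpa using h.symm

omit [DecidableEq State] in
theorem value_nonneg (π : HistPolicy State K) {f : State → ArmPair K → ℝ}
    (h : ∀ s a, 0 ≤ f s a) : 0 ≤ M.value π M.init f := by
  have := M.futureSum_mono π h H [] M.init
  rwa [futureSum_const, mul_zero, ← value_eq_futureSum] at this

omit [DecidableEq State] in
theorem value_le (π : HistPolicy State K) {f : State → ArmPair K → ℝ}
    (h : ∀ s a, f s a ≤ 1) : M.value π M.init f ≤ H := by
  have := M.futureSum_mono π h H [] M.init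
  rwa [futureSum_const, mul_one, ← value_eq_futureSum] at this

omit [DecidableEq State] in
/-- The temporal differences of a function that vanishes on the last layer telescope. -/
theorem futureSum_temporal_difference (π : HistPolicy State K) {V : State → ℝ}
    (hV : ∀ s, M.layer s = H → V s = 0) (n : ℕ) :
    ∀ (past : List (State × ArmPair K)) (s : State), n + M.layer s = H →
      M.futureSum π (fun s a => V s - ∑ s', (M.trans s a s').toReal * V s') n past s = V s := by
  induction n with
  | zero => intro past s hn; rw [hV s (by omega)]; rfl
  | succ n ih =>
    intro past s hn
    have h : ∀ a, ∑ s', (M.trans s a s').toReal * M.futureSum π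
        (fun s a => V s - ∑ s', (M.trans s a s').toReal * V s') n ((s, a) :: past) s' =
        ∑ s', (M.trans s a s').toReal * V s' := fun a =>
      M.sum_trans_toReal_mul_congr hn.le fun s' hs' => ih _ s' (by omega)
    simp only [futureSum, h, sub_add_cancel, ← Finset.sum_mul, sum_univ_toReal, one_mul]

/-- The flow equations that characterize occupancy measures. -/
structure IsFlow (q : State → ArmPair K → ℝ) : Prop where
  nonneg : ∀ s a, 0 ≤ q s a
  eq_zero : ∀ s a, ¬ M.layer s < H → q s a = 0
  balance : ∀ s, M.layer s < H →
    stateMass q s = (if s = M.init then 1 else 0) +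
      ∑ s', ∑ a, q s' a * (M.trans s' a s).toReal

theorem occ_isFlow (π : HistPolicy State K) : M.IsFlow (M.occ π) where
  nonneg := M.occ_nonneg π
  eq_zero s a hs := by
    have h : ∀ n past s', n + M.layer s' ≤ H →
        M.futureSum π (fun s' a' => if s' = s ∧ a' = a then 1 else 0) n past s' = 0 := by
      intro n
      induction n with
      | zero => intro past s' _; rfl
      | succ n ih =>
        intro past s' hn
        have hne : s' ≠ s := by rintro rfl; omega
        refine Finset.sum_eq_zero fun b _ => ?_
        rw [M.sum_trans_toReal_mul_congr hn (g := fun _ => 0) fun s'' hs'' => ih _ s'' (by omega)]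
        simp [hne]
    rw [occ_eq_futureSum, h _ _ _ (by rw [layer_init]; simp)]
  balance s hs := by
    -- Pairing the temporal differences of the indicator of `s` with the occupancy measure gives
    -- outflow minus inflow at `s`; the indicator vanishes on the last layer because `s` is not
    -- terminal.
    have h := M.futureSum_temporal_difference π (V := fun s' => if s' = s then 1 else 0)
      (fun s' hs' => if_neg (by rintro rfl; omega)) H [] M.init (by rw [layer_init]; simp)
    rw [← value_eq_futureSum, value_eq_sum_occ] at h
    simp only [mul_ite, mul_one, mul_zero, Finset.sum_ite_eq', Finset.mem_univ, if_true,
      mul_sub, Finset.sum_sub_distrib] at h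
    rw [stateMass]
    have h1 : ∑ s', ∑ a, (if s' = s then M.occ π s' a else 0) = ∑ a, M.occ π s a := by
      rw [Finset.sum_comm]; simp
    rw [h1] at h
    simp only [eq_comm (a := s) (b := M.init)]
    linarith

/-- The function `1[a' = a] - π(a | s)`, supported at `s`, has mean zero under `π` at every step, so
its value is zero. Expressing that value through the occupancy measure gives the identity. -/
theorem occ_markov_eq (π : Policy State K) (s : State) (a : ArmPair K) :
    M.occ π.toHist s a = stateMass (M.occ π.toHist) s * (π s a).toReal := by
  have h : ∀ n past s', M.futureSum π.toHist (fun s' a' => if s' = s then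
      (if a' = a then 1 else 0) - (π s a).toReal else 0) n past s' = 0 := by
    intro n
    induction n with
    | zero => intro past s'; rfl
    | succ n ih =>
      intro past s'
      simp only [futureSum, ih, mul_zero, Finset.sum_const_zero, add_zero, Policy.toHist]
      by_cases hs : s' = s
      · subst hs
        simp [mul_sub, Finset.sum_sub_distrib, ← Finset.sum_mul, sum_univ_toReal]
      · simp [hs]
  have h' := h H [] M.init
  rw [← value_eq_futureSum, value_eq_sum_occ, Finset.sum_eq_single s
    (by intro b _ hb; simp [hb]) (by simp)] at h'
  simp only [if_true, mul_sub, Finset.sum_sub_distrib, mul_ite, mul_one, mul_zero,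
    Finset.sum_ite_eq', Finset.mem_univ, ← Finset.sum_mul] at h'
  rw [stateMass]
  linarith

/-! ### Flows are the occupancy measures of Markov policies. -/

variable {M}

omit [Fintype State] [DecidableEq State] in
theorem stateMass_nonneg {q : State → ArmPair K → ℝ} (h : ∀ s a, 0 ≤ q s a) (s : State) :
    0 ≤ stateMass q s := Finset.sum_nonneg fun a _ => h s a

omit [Fintype State] [DecidableEq State] in
theorem le_stateMass {q : State → ArmPair K → ℝ} (h : ∀ s a, 0 ≤ q s a) (s : State)
    (a : ArmPair K) : q s a ≤ stateMass q s :=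
  Finset.single_le_sum (f := fun a => q s a) (fun a _ => h s a) (Finset.mem_univ a)

theorem IsFlow.eq_mul_of_isInducedBy {q : State → ArmPair K → ℝ} (hq : M.IsFlow q)
    {π : Policy State K} (h : IsInducedBy π q) (s : State) (a : ArmPair K) :
    q s a = stateMass q s * (π s a).toReal := by
  rcases (stateMass_nonneg hq.nonneg s).eq_or_lt with h0 | h0
  · have := le_stateMass hq.nonneg s a
    have := hq.nonneg s a
    rw [← h0, zero_mul]
    linarith
  · rw [h s h0 a]
    field_simp

/-- Induction on the layer: the balance equation determines the mass of a state from the preceding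
layer, and the induced policy splits that mass among the actions. -/
theorem IsFlow.occ_eq {q : State → ArmPair K → ℝ} (hq : M.IsFlow q)
    {π : Policy State K} (h : IsInducedBy π q) : M.occ π.toHist = q := by
  have hπ := M.occ_isFlow π.toHist
  have key : ∀ n s, M.layer s = n → ∀ a, M.occ π.toHist s a = q s a := by
    intro n
    induction n using Nat.strong_induction_on with
    | _ n ih =>
      intro s hs a
      by_cases hH : M.layer s < H
      · rw [hq.eq_mul_of_isInducedBy h, M.occ_markov_eq, hπ.balance s hH, hq.balance s hH]
        congr 2
        refine Finset.sum_congr rfl fun s' _ => Finset.sum_congr rfl fun b _ => ?_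
        by_cases hs' : M.layer s' < H
        · by_cases hm : M.trans s' b s = 0
          · simp [hm]
          · have hl := M.layer_trans s' b s hs' ((PMF.mem_support_iff _ _).mpr hm)
            rw [ih (M.layer s') (by omega) s' rfl b]
        · rw [hπ.eq_zero s' b hs', hq.eq_zero s' b hs']
      · rw [hπ.eq_zero s a hH, hq.eq_zero s a hH]
  funext s a
  exact key _ s rfl a

omit [Fintype State] [DecidableEq State] in
theorem exists_isInducedBy [NeZero K] {q : State → ArmPair K → ℝ} (hq : ∀ s a, 0 ≤ q s a) :
    ∃ π : Policy State K, IsInducedBy π q := by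
  have h : ∀ s, ∃ p : PMF (ArmPair K), 0 < stateMass q s → ∀ a,
      (p a).toReal = q s a / stateMass q s := by
    intro s
    by_cases h0 : 0 < stateMass q s
    · refine ⟨PMF.ofFintype (fun a => ENNReal.ofReal (q s a / stateMass q s)) ?_, fun _ a => ?_⟩
      · rw [← ENNReal.ofReal_sum_of_nonneg fun a _ => div_nonneg (hq s a) h0.le,
          ← Finset.sum_div]
        change ENNReal.ofReal (stateMass q s / stateMass q s) = 1
        rw [div_self h0.ne', ENNReal.ofReal_one]
      · rw [PMF.ofFintype_apply, ENNReal.toReal_ofReal (div_nonneg (hq s a) h0.le)]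
    · exact ⟨PMF.pure (0, 0), fun h => absurd h h0⟩
  choose π hπ using h
  exact ⟨π, hπ⟩

theorem isFlow_of_mem_occSet {q : State → ArmPair K → ℝ} (hq : q ∈ M.occSet) : M.IsFlow q := by
  obtain ⟨π, rfl⟩ := hq
  exact M.occ_isFlow _

theorem IsFlow.mem_occSet [NeZero K] {q : State → ArmPair K → ℝ} (hq : M.IsFlow q) :
    q ∈ M.occSet := by
  obtain ⟨π, hπ⟩ := exists_isInducedBy hq.nonneg
  exact ⟨π, (hq.occ_eq hπ).symm⟩

/-- The flow conditions are affine equations and sign constraints; the unit source at the initial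
state survives because the weights sum to one. -/
theorem occSet_convex [NeZero K] : Convex ℝ (M.occSet) := by
  intro q hq r hr x y hx hy hxy
  have hq := isFlow_of_mem_occSet hq
  have hr := isFlow_of_mem_occSet hr
  refine IsFlow.mem_occSet ⟨fun s a => ?_, fun s a hs => ?_, fun s hs => ?_⟩
  · have := hq.nonneg s a
    have := hr.nonneg s a
    simp only [Pi.add_apply, Pi.smul_apply, smul_eq_mul]
    positivity
  · simp [hq.eq_zero s a hs, hr.eq_zero s a hs]
  · have h1 := hq.balance s hs
    have h2 := hr.balance s hs
    have h3 : stateMass (x • q + y • r) s = x * stateMass q s + y * stateMass r s := by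
      simp [stateMass, Finset.sum_add_distrib, Finset.mul_sum]
    rw [h3, h1, h2]
    simp only [Pi.add_apply, Pi.smul_apply, smul_eq_mul, add_mul, Finset.sum_add_distrib,
      mul_assoc, ← Finset.mul_sum]
    have : x * (if s = M.init then (1 : ℝ) else 0) + y * (if s = M.init then 1 else 0) =
        if s = M.init then 1 else 0 := by rw [← add_mul, hxy, one_mul]
    linarith

end Fintype

end LayeredMDP


/-! ## Feedback and the Borda loss -/

namespace Preference

variable {State : Type u} {K : ℕ} (p : Preference State K)

theorem feedbackLaw_support_finite (path : List (State × ArmPair K)) :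
    (p.feedbackLaw path).support.Finite := by
  induction path with
  | nil => simp [feedbackLaw]
  | cons x path ih =>
    exact finite_support_bind (Set.toFinite _) fun o => finite_support_map ih _

theorem map_eq_of_mem_feedbackLaw (path : List (State × ArmPair K)) :
    ∀ steps ∈ (p.feedbackLaw path).support, steps.map (fun x => (x.1, x.2.1)) = path := by
  induction path with
  | nil => intro steps h; simp [feedbackLaw] at h; simp [h]
  | cons x path ih =>
    intro steps h
    simp only [feedbackLaw, PMF.mem_support_bind_iff, PMF.mem_support_map_iff] at h
    obtain ⟨o, _, rest, hrest, rfl⟩ := h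
    simp [ih rest hrest]

theorem expect_feedbackLaw_sum (φ : State × ArmPair K × Bool → ℝ)
    (path : List (State × ArmPair K)) :
    expect (p.feedbackLaw path) (fun steps => (steps.map φ).sum) =
      (path.map fun x => expect (coin (p.prob x.1 x.2)) fun o => φ (x.1, x.2, o)).sum := by
  induction path with
  | nil => simp [feedbackLaw, expect_pure]
  | cons x path ih =>
    have hfin := p.feedbackLaw_support_finite path
    rw [feedbackLaw, expect_bind (Set.toFinite _) fun o => finite_support_map hfin _,
      List.map_cons, List.sum_cons, ← ih, ← expect_const (p := coin (p.prob x.1 x.2))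
        (Set.toFinite _) (expect (p.feedbackLaw path) _), ← expect_add (Set.toFinite _)]
    refine expect_congr fun o _ => ?_
    rw [expect_map hfin]
    simp only [List.map_cons, List.sum_cons]
    rw [expect_add hfin, expect_const hfin]

variable [NeZero K]

omit [NeZero K] in
-- Up to sign, the shifted score is the probability of feedback `0` against a uniform opponent. This
-- is the quantity that exploration counts.
theorem borda_eq (s : State) (i : Fin K) :
    p.borda s i = -((∑ j, (1 - (p.prob s (i, j) : ℝ))) / K) := by
  rw [borda, ← neg_div, ← Finset.sum_neg_distrib]
  simp only [neg_sub]
  ring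

omit [NeZero K] in
theorem borda_nonpos (s : State) (i : Fin K) : p.borda s i ≤ 0 := by
  rw [borda_eq, neg_nonpos]
  exact div_nonneg (Finset.sum_nonneg fun j _ => sub_nonneg.mpr (p.prob s (i, j)).2.2)
    (Nat.cast_nonneg _)

theorem neg_one_le_borda (s : State) (i : Fin K) : -1 ≤ p.borda s i := by
  have hK : (0 : ℝ) < K := Nat.cast_pos.mpr (NeZero.pos K)
  rw [borda_eq, neg_le_neg_iff, div_le_one hK]
  calc ∑ j, (1 - (p.prob s (i, j) : ℝ)) ≤ ∑ _j : Fin K, (1 : ℝ) :=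
        Finset.sum_le_sum fun j _ => sub_le_self _ (p.prob s (i, j)).2.1
    _ = K := by simp

omit [NeZero K] in
theorem loss_nonneg (s : State) (a : ArmPair K) : 0 ≤ p.loss s a := by
  have := p.borda_nonpos s a.1
  have := p.borda_nonpos s a.2
  rw [loss]
  linarith

theorem loss_le_one (s : State) (a : ArmPair K) : p.loss s a ≤ 1 := by
  have := p.neg_one_le_borda s a.1
  have := p.neg_one_le_borda s a.2
  rw [loss]
  linarith

end Preference

/-! ## Exploration episodes -/

section Exploration

variable {State : Type u} [Fintype State] [DecidableEq State] {K H : ℕ} [NeZero K]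

omit [DecidableEq State] [NeZero K] in
theorem LayeredMDP.numStates_pos (M : LayeredMDP State K H) : 0 < M.numStates :=
  M.activeStates_nonempty.card_pos

theorem uniformArms_toReal (a : ArmPair K) : (uniformArms K a).toReal = 1 / (K : ℝ) ^ 2 := by
  simp [uniformArms, pow_two]

/-- Until `g` is reached both policies act alike; at `g` the uniform draw hits `b` with probability
`1 / K²`; afterwards `g` cannot recur, so the arbitrary continuation is invisible. -/
theorem futureSum_executed (M : LayeredMDP State K H) (c : Choices State K)
    (history : List (Episode State K)) (g : State) (b : ArmPair K) (n : ℕ) :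
    ∀ (past : List (State × ArmPair K)) (s : State), n + M.layer s ≤ H → g ∉ past.map Prod.fst →
      M.futureSum (c.executed history (some g))
          (fun s' a' => if s' = g ∧ a' = b then 1 else 0) n past s =
        1 / (K : ℝ) ^ 2 * M.futureSum (c.reachPolicy g).toHist
          (fun s' _ => if s' = g then 1 else 0) n past s := by
  induction n with
  | zero => intro past s _ _; simp [LayeredMDP.futureSum]
  | succ n ih =>
    intro past s hn hg
    simp only [LayeredMDP.futureSum]
    have hpolicy : c.executed history (some g) past s =
        if s = g then uniformArms K else c.reachPolicy g s := by
      simp only [Choices.executed, if_neg hg]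
    rw [hpolicy]
    by_cases hs : s = g
    · subst hs
      -- All later states lie in deeper layers than the target.
      have hzero : ∀ (π : HistPolicy State K) (f : State → ArmPair K → ℝ),
          (∀ s' a, s' ≠ s → f s' a = 0) → ∀ a, ∑ s', (M.trans s a s').toReal *
            M.futureSum π f n ((s, a) :: past) s' = 0 := by
        intro π f hf a
        rw [M.sum_trans_toReal_mul_congr hn (g := fun _ => 0) fun s' hs' =>
          M.futureSum_eq_zero_of_layer_lt π hf n _ s' (by omega) (by omega)]
        simp
      have h1 := hzero (c.executed history (some s))
        (fun s' a' => if s' = s ∧ a' = b then 1 else 0) (by intro s' a h; simp [h])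
      have h2 := hzero (c.reachPolicy s).toHist (fun s' _ => if s' = s then 1 else 0)
        (by intro s' a h; simp [h])
      simp only [h1, h2, if_true, true_and, add_zero, mul_one, mul_ite, mul_zero,
        Finset.sum_ite_eq', Finset.mem_univ, sum_univ_toReal, uniformArms_toReal]
    · rw [if_neg hs, Finset.mul_sum]
      refine Finset.sum_congr rfl fun a _ => ?_
      rw [M.sum_trans_toReal_mul_congr hn fun s' hs' =>
        ih ((s, a) :: past) s' (by omega) (by simpa [eq_comm (a := g), hs] using hg)]
      simp only [hs, false_and, if_false, zero_add, Policy.toHist, Finset.mul_sum]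
      exact Finset.sum_congr rfl fun s' _ => by ring

/-- An exploration episode plays a uniform pair of arms at its target state. -/
theorem occ_executed (M : LayeredMDP State K H) (c : Choices State K)
    (history : List (Episode State K)) (g : State) (b : ArmPair K) :
    M.occ (c.executed history (some g)) g b =
      stateMass (M.occ (c.reachPolicy g).toHist) g / (K : ℝ) ^ 2 := by
  rw [LayeredMDP.occ_eq_futureSum, futureSum_executed _ _ _ _ _ _ _ _
    (by rw [LayeredMDP.layer_init]; simp) (by simp), ← LayeredMDP.value_eq_futureSum,
    LayeredMDP.value_eq_sum_occ, Finset.sum_eq_single g (by intro s _ hs; simp [hs]) (by simp)]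
  simp only [if_true, mul_one, stateMass]
  ring

theorem stateMass_occ_executed (M : LayeredMDP State K H) (c : Choices State K)
    (history : List (Episode State K)) (g : State) :
    stateMass (M.occ (c.executed history (some g))) g =
      stateMass (M.occ (c.reachPolicy g).toHist) g := by
  have hK : (K : ℝ) ≠ 0 := NeZero.ne _
  rw [stateMass]
  simp only [occ_executed, Finset.sum_const, Finset.card_univ, Fintype.card_prod, Fintype.card_fin,
    nsmul_eq_mul, Nat.cast_mul]
  field_simp

theorem condAction_executed (M : LayeredMDP State K H) (c : Choices State K)
    (history : List (Episode State K)) {g : State}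
    (hg : 0 < stateMass (M.occ (c.reachPolicy g).toHist) g) (a : ArmPair K) :
    condAction M (c.executed history (some g)) g a = 1 / (K : ℝ) ^ 2 := by
  rw [condAction, stateMass_occ_executed, occ_executed]
  field_simp

/-- The number of steps at `s` with left arm `i` and feedback `0`. -/
def missCount (s : State) (i : Fin K) (steps : List (State × ArmPair K × Bool)) : ℝ :=
  (steps.map fun x => if x.1 = s ∧ x.2.1.1 = i ∧ x.2.2 = false then (1 : ℝ) else 0).sum

omit [Fintype State] [NeZero K] in
theorem missCount_eq_zero {s : State} (i : Fin K) {steps : List (State × ArmPair K × Bool)}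
    (h : s ∉ steps.map Prod.fst) : missCount s i steps = 0 := by
  refine List.sum_eq_zero fun y hy => ?_
  obtain ⟨x, hx, rfl⟩ := List.mem_map.mp hy
  refine if_neg fun h' => h ?_
  exact h'.1 ▸ List.mem_map_of_mem hx

omit [Fintype State] [NeZero K] in
-- Without repeated states the count is `0` or `1`. Hence second moments of the estimator reduce to
-- first moments of the count.
theorem missCount_sq {s : State} (i : Fin K) {steps : List (State × ArmPair K × Bool)}
    (h : (steps.map Prod.fst).Nodup) : missCount s i steps ^ 2 = missCount s i steps := by
  induction steps with
  | nil => simp [missCount]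
  | cons x steps ih =>
    rw [List.map_cons, List.nodup_cons] at h
    have hcons : missCount s i (x :: steps) =
        (if x.1 = s ∧ x.2.1.1 = i ∧ x.2.2 = false then (1 : ℝ) else 0) + missCount s i steps := by
      simp [missCount]
    by_cases hx : x.1 = s ∧ x.2.1.1 = i ∧ x.2.2 = false
    · rw [hcons, if_pos hx, missCount_eq_zero i (hx.1 ▸ h.1)]
      norm_num
    · rw [hcons, if_neg hx, zero_add, ih h.2]

/-- Both marginals of the uniform pair are `1 / K`: one cancels the factor `K` in the estimator, the
other leaves a factor `K`. The numerator `o - 1` is nonzero only for feedback `0`. -/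
theorem bHat_executed (M : LayeredMDP State K H) (c : Choices State K)
    (history : List (Episode State K)) {g : State}
    (hg : 0 < stateMass (M.occ (c.reachPolicy g).toHist) g)
    (steps : List (State × ArmPair K × Bool)) (i : Fin K) :
    bHat M (c.executed history (some g)) steps g i = -(K * missCount g i steps) := by
  have hK : (K : ℝ) ≠ 0 := NeZero.ne _
  have hrow : (K : ℝ) * (1 / (K : ℝ) ^ 2) = 1 / K := by field_simp
  simp only [bHat, condAction_executed M c history hg, Finset.sum_const, Finset.card_univ,
    Fintype.card_fin, nsmul_eq_mul, hrow]
  induction steps with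
  | nil => simp [missCount]
  | cons x steps ih =>
    have hcons : missCount g i (x :: steps) =
        (if x.1 = g ∧ x.2.1.1 = i ∧ x.2.2 = false then (1 : ℝ) else 0) + missCount g i steps := by
      simp [missCount]
    rw [hcons, List.filter_cons]
    by_cases hx : x.1 = g
    · simp only [hx, decide_true, if_true, List.map_cons, List.sum_cons, true_and, ih]
      by_cases hi : x.2.1.1 = i <;> cases x.2.2 <;> simp [hi]
      field_simp
      ring
    · simp only [hx, decide_false, Bool.false_eq_true, if_false, false_and, zero_add, ih]

theorem bTilde_eq (M : LayeredMDP State K H) (γ : Set.Ioc (0 : ℝ) (1 / 2)) (c : Choices State K)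
    (history : List (Episode State K)) {s : State}
    (hs : 0 < stateMass (M.occ (c.reachPolicy s).toHist) s) (e : Episode State K) (i : Fin K) :
    bTilde M γ c history e s i = if e.draw = some s then
      -(M.numStates * K / ((γ : ℝ) * stateMass (M.occ (c.reachPolicy s).toHist) s)) *
        missCount s i e.steps else 0 := by
  rw [bTilde]
  by_cases hd : e.draw = some s
  · rw [hd, if_pos rfl, if_pos rfl, stateMass_occ_executed, bHat_executed M c history hs]
    by_cases hv : s ∈ e.steps.map Prod.fst
    · rw [if_pos hv]
      ring
    · rw [if_neg hv, missCount_eq_zero i hv]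
      ring
  · rw [if_neg hd, if_neg hd]
    ring

/-! ### Conditional moments of the loss estimator. -/

omit [DecidableEq State] [NeZero K] in
theorem drawLaw_support_finite (M : LayeredMDP State K H) (γ : Set.Ioc (0 : ℝ) (1 / 2)) :
    (drawLaw M γ).support.Finite := Set.toFinite _

omit [NeZero K] in
theorem expect_drawLaw (M : LayeredMDP State K H) (γ : Set.Ioc (0 : ℝ) (1 / 2))
    (f : Option State → ℝ) :
    expect (drawLaw M γ) f =
      (1 - γ) * f none + γ * (1 / M.numStates * ∑ s ∈ M.activeStates, f (some s)) := by
  rw [drawLaw, expect_bind (Set.toFinite _) fun _ => Set.toFinite _, expect_coin]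
  simp only [if_true, Bool.false_eq_true, if_false]
  rw [expect_pure, expect_map (Set.toFinite _), expect_eq_sum_univ]
  have h : ∀ s, (PMF.uniformOfFinset M.activeStates M.activeStates_nonempty s).toReal =
      if s ∈ M.activeStates then 1 / (M.numStates : ℝ) else 0 := by
    intro s
    rw [PMF.uniformOfFinset_apply]
    split_ifs <;> simp [LayeredMDP.numStates]
  simp only [h, ite_mul, zero_mul, Finset.sum_ite_mem, Finset.univ_inter, Finset.mul_sum]
  ring

omit [DecidableEq State] [NeZero K] in
theorem steps_support_finite (M : LayeredMDP State K H) (p : Preference State K)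
    (π : HistPolicy State K) (d : Option State) :
    ((M.pathLaw π M.init).bind fun path =>
      (p.feedbackLaw path).map fun steps => (⟨d, steps⟩ : Episode State K)).support.Finite :=
  finite_support_bind (M.pathLaw_support_finite _ _) fun _ =>
    finite_support_map (p.feedbackLaw_support_finite _) _

theorem episodeLaw_support_finite (M : LayeredMDP State K H) (γ : Set.Ioc (0 : ℝ) (1 / 2))
    (c : Choices State K) (p : Preference State K) (past : List (Episode State K)) :
    (episodeLaw M γ c p past).support.Finite :=
  finite_support_bind (drawLaw_support_finite M γ) fun _ => steps_support_finite M p _ _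

theorem expect_episodeLaw (M : LayeredMDP State K H) (γ : Set.Ioc (0 : ℝ) (1 / 2))
    (c : Choices State K) (p : Preference State K) (past : List (Episode State K))
    (f : Episode State K → ℝ) :
    expect (episodeLaw M γ c p past) f = expect (drawLaw M γ) fun d =>
      expect (M.pathLaw (c.executed past d) M.init) fun path =>
        expect (p.feedbackLaw path) fun steps => f ⟨d, steps⟩ := by
  rw [episodeLaw, expect_bind (drawLaw_support_finite M γ) fun _ => steps_support_finite M p _ _]
  refine expect_congr fun d _ => ?_
  rw [expect_bind (M.pathLaw_support_finite _ _) fun _ =>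
    finite_support_map (p.feedbackLaw_support_finite _) _]
  exact expect_congr fun path _ => expect_map (p.feedbackLaw_support_finite _) _ _

theorem missCount_sq_of_mem_episodeLaw {M : LayeredMDP State K H} {γ : Set.Ioc (0 : ℝ) (1 / 2)}
    {c : Choices State K} {p : Preference State K} {past : List (Episode State K)}
    {e : Episode State K} (he : e ∈ (episodeLaw M γ c p past).support) (s : State) (i : Fin K) :
    missCount s i e.steps ^ 2 = missCount s i e.steps := by
  simp only [episodeLaw, PMF.mem_support_bind_iff, PMF.mem_support_map_iff] at he
  obtain ⟨d, _, path, hpath, steps, hsteps, rfl⟩ := he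
  refine missCount_sq i ?_
  have h := M.pairwise_layer_of_mem_pathLaw _ hpath
  rw [← p.map_eq_of_mem_feedbackLaw path steps hsteps] at h
  rw [List.pairwise_map] at h
  rw [List.Nodup, List.pairwise_map]
  exact h.imp fun hxy he => by simp [he] at hxy

/-- The target is reached with probability `m_s`, the left arm is `i` with probability `1 / K`, and
averaging over the uniform right arm turns the probability of feedback `0` into `-b(s, i)`. -/
theorem expect_missCount (M : LayeredMDP State K H) (p : Preference State K)
    (c : Choices State K) (past : List (Episode State K)) (s : State) (i : Fin K) :
    (expect (M.pathLaw (c.executed past (some s)) M.init) fun path =>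
      expect (p.feedbackLaw path) fun steps => missCount s i steps) =
      stateMass (M.occ (c.reachPolicy s).toHist) s / K * -p.borda s i := by
  have hK : (K : ℝ) ≠ 0 := NeZero.ne _
  have h : ∀ path, expect (p.feedbackLaw path) (fun steps => missCount s i steps) =
      (path.map fun x => (fun s' (a : ArmPair K) =>
        if s' = s ∧ a.1 = i then 1 - (p.prob s' a : ℝ) else 0) x.1 x.2).sum := by
    intro path
    simp only [missCount]
    rw [p.expect_feedbackLaw_sum]
    congr 2
    funext x
    rw [expect_coin]
    by_cases h1 : x.1 = s <;> by_cases h2 : x.2.1 = i <;> simp [h1, h2]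
  rw [expect_congr fun path _ => h path]
  have hv := M.value_eq_sum_occ (c.executed past (some s)) (fun s' (a : ArmPair K) =>
    if s' = s ∧ a.1 = i then 1 - (p.prob s' a : ℝ) else 0)
  rw [LayeredMDP.value] at hv
  rw [hv, Finset.sum_eq_single s (by intro b _ hb; simp [hb]) (by simp)]
  simp only [true_and, occ_executed, Fintype.sum_prod_type, mul_ite, mul_zero, p.borda_eq]
  rw [Finset.sum_comm]
  simp only [Finset.sum_ite_eq', Finset.mem_univ, if_true, ← Finset.mul_sum]
  field_simp

/-- The target `s` is drawn with probability `γ / S`. The factor `x` is left free so that the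
identity serves both the first and the second moment. -/
theorem expect_target_missCount (M : LayeredMDP State K H) (γ : Set.Ioc (0 : ℝ) (1 / 2))
    (c : Choices State K) (p : Preference State K) (past : List (Episode State K)) {s : State}
    (hs : s ∈ M.activeStates) (i : Fin K) (x : ℝ) :
    expect (episodeLaw M γ c p past)
        (fun e => if e.draw = some s then x * missCount s i e.steps else 0) =
      γ / M.numStates * x * (stateMass (M.occ (c.reachPolicy s).toHist) s / K * -p.borda s i) := by
  have h : ∀ d : Option State, (expect (M.pathLaw (c.executed past d) M.init) fun path =>
      expect (p.feedbackLaw path) fun steps =>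
        if d = some s then x * missCount s i steps else 0) =
      if d = some s then
        x * (stateMass (M.occ (c.reachPolicy s).toHist) s / K * -p.borda s i) else 0 := by
    intro d
    by_cases hd : d = some s
    · subst hd
      simp only [if_true]
      rw [← expect_missCount M p c past s i, ← expect_const_mul (M.pathLaw_support_finite _ _)]
      exact expect_congr fun path _ => expect_const_mul (p.feedbackLaw_support_finite _) _ _
    · simp only [if_neg hd]
      rw [expect_congr fun path _ => expect_const (p.feedbackLaw_support_finite path) 0,
        expect_const (M.pathLaw_support_finite _ _)]
  rw [expect_episodeLaw, expect_congr fun d _ => h d, expect_drawLaw]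
  simp only [Option.some.injEq, reduceCtorEq, if_false, Finset.sum_ite_eq', hs, if_true]
  ring

theorem expect_bTilde (M : LayeredMDP State K H) (γ : Set.Ioc (0 : ℝ) (1 / 2))
    (c : Choices State K) (p : Preference State K) (past : List (Episode State K)) {s : State}
    (hs : s ∈ M.activeStates) (hm : 0 < stateMass (M.occ (c.reachPolicy s).toHist) s)
    (i : Fin K) :
    expect (episodeLaw M γ c p past) (fun e => bTilde M γ c past e s i) = p.borda s i := by
  have hK : (K : ℝ) ≠ 0 := NeZero.ne _
  have hS : (M.numStates : ℝ) ≠ 0 := Nat.cast_ne_zero.mpr M.numStates_pos.ne'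
  have hγ : (γ : ℝ) ≠ 0 := γ.2.1.ne'
  rw [expect_congr fun e _ => bTilde_eq M γ c past hm e i, expect_target_missCount _ _ _ _ _ hs]
  field_simp

theorem expect_bTilde_sq_le (M : LayeredMDP State K H) (γ : Set.Ioc (0 : ℝ) (1 / 2))
    (c : Choices State K) (p : Preference State K) (past : List (Episode State K)) {s : State}
    (hs : s ∈ M.activeStates) (hm : 0 < stateMass (M.occ (c.reachPolicy s).toHist) s)
    (i : Fin K) :
    expect (episodeLaw M γ c p past) (fun e => bTilde M γ c past e s i ^ 2) ≤
      M.numStates * K / ((γ : ℝ) * stateMass (M.occ (c.reachPolicy s).toHist) s) := by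
  have hK : (K : ℝ) ≠ 0 := NeZero.ne _
  have hS : (M.numStates : ℝ) ≠ 0 := Nat.cast_ne_zero.mpr M.numStates_pos.ne'
  have hγ : (0 : ℝ) < γ := γ.2.1
  set m := stateMass (M.occ (c.reachPolicy s).toHist) s
  have h : ∀ e ∈ (episodeLaw M γ c p past).support, bTilde M γ c past e s i ^ 2 =
      if e.draw = some s then (M.numStates * K / ((γ : ℝ) * m)) ^ 2 * missCount s i e.steps else 0 := by
    intro e he
    rw [bTilde_eq M γ c past hm]
    split_ifs
    · rw [mul_pow, missCount_sq_of_mem_episodeLaw he, neg_sq]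
    · norm_num
  rw [expect_congr h, expect_target_missCount _ _ _ _ _ hs]
  change (γ : ℝ) / M.numStates * (M.numStates * K / ((γ : ℝ) * m)) ^ 2 * (m / K * -p.borda s i) ≤ _
  have hid : (γ : ℝ) / M.numStates * (M.numStates * K / ((γ : ℝ) * m)) ^ 2 * (m / K * -p.borda s i) =
      M.numStates * K / ((γ : ℝ) * m) * -p.borda s i := by
    field_simp
  rw [hid]
  refine mul_le_of_le_one_right (by positivity) ?_
  have := p.neg_one_le_borda s i
  linarith

theorem expect_lossHat (M : LayeredMDP State K H) (γ : Set.Ioc (0 : ℝ) (1 / 2))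
    (c : Choices State K) (p : Preference State K) (past : List (Episode State K)) {s : State}
    (hs : s ∈ M.activeStates) (hm : 0 < stateMass (M.occ (c.reachPolicy s).toHist) s)
    (a : ArmPair K) :
    expect (episodeLaw M γ c p past) (fun e => lossHat M γ c past e s a) = p.loss s a := by
  have hfin := episodeLaw_support_finite M γ c p past
  simp only [lossHat]
  rw [expect_const_mul hfin, expect_add hfin, expect_bTilde M γ c p past hs hm,
    expect_bTilde M γ c p past hs hm, Preference.loss]

theorem expect_lossHat_sq_le (M : LayeredMDP State K H) (γ : Set.Ioc (0 : ℝ) (1 / 2))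
    (c : Choices State K) (p : Preference State K) (past : List (Episode State K)) {s : State}
    (hs : s ∈ M.activeStates) (hm : 0 < stateMass (M.occ (c.reachPolicy s).toHist) s)
    (a : ArmPair K) :
    expect (episodeLaw M γ c p past) (fun e => lossHat M γ c past e s a ^ 2) ≤
      M.numStates * K / ((γ : ℝ) * stateMass (M.occ (c.reachPolicy s).toHist) s) := by
  have hfin := episodeLaw_support_finite M γ c p past
  have h1 := expect_bTilde_sq_le M γ c p past hs hm a.1
  have h2 := expect_bTilde_sq_le M γ c p past hs hm a.2
  have h3 : expect (episodeLaw M γ c p past) (fun e => lossHat M γ c past e s a ^ 2) ≤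
      expect (episodeLaw M γ c p past) fun e => 1 / 2 *
        (bTilde M γ c past e s a.1 ^ 2 + bTilde M γ c past e s a.2 ^ 2) :=
    expect_mono hfin fun e _ => by
      rw [lossHat]
      nlinarith [sq_nonneg (bTilde M γ c past e s a.1 - bTilde M γ c past e s a.2)]
  rw [expect_const_mul hfin, expect_add hfin] at h3
  linarith

/-- The shift makes the factor `o - 1` nonpositive. This sure sign is what the quadratic bound on
`exp (-y)` requires in the regularized-leader step. -/
theorem lossHat_nonneg (M : LayeredMDP State K H) (γ : Set.Ioc (0 : ℝ) (1 / 2))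
    (c : Choices State K) (past : List (Episode State K)) (e : Episode State K) (s : State)
    (a : ArmPair K) : 0 ≤ lossHat M γ c past e s a := by
  have hcond : ∀ b, 0 ≤ condAction M (c.executed past e.draw) s b := fun b =>
    div_nonneg (M.occ_nonneg _ _ _) (LayeredMDP.stateMass_nonneg (M.occ_nonneg _) s)
  have hb : ∀ i, bTilde M γ c past e s i ≤ 0 := by
    intro i
    have hhat : bHat M (c.executed past e.draw) e.steps s i ≤ 0 := by
      refine (List.sum_le_card_nsmul _ 0 fun y hy => ?_).trans (by simp)
      obtain ⟨x, _, rfl⟩ := List.mem_map.mp hy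
      refine mul_nonpos_of_nonneg_of_nonpos (div_nonneg (by split_ifs <;> norm_num)
        (mul_nonneg (Nat.cast_nonneg _) (Finset.sum_nonneg fun _ _ => hcond _)))
        (div_nonpos_of_nonpos_of_nonneg (by split_ifs <;> norm_num)
          (Finset.sum_nonneg fun _ _ => hcond _))
    refine mul_nonpos_of_nonneg_of_nonpos (mul_nonneg (mul_nonneg (div_nonneg (Nat.cast_nonneg _)
      (mul_nonneg γ.2.1.le (LayeredMDP.stateMass_nonneg (M.occ_nonneg _) s))) ?_) ?_) hhat
    all_goals split_ifs <;> norm_num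
  have := hb a.1
  have := hb a.2
  rw [lossHat]
  linarith

end Exploration


/-! ## Follow the regularized leader with entropy regularization -/

/-- Nonnegativity of the scalar relative entropy: `x log x` lies above its tangent at `r`. -/
theorem mul_log_add_sub_le {x r : ℝ} (hx : 0 ≤ x) (hr : 0 < r) :
    x * Real.log r + x - r ≤ x * Real.log x := by
  rcases hx.eq_or_lt with rfl | hx
  · simp [hr.le]
  · have h := Real.log_le_sub_one_of_pos (div_pos hr hx)
    rw [Real.log_div hr.ne' hx.ne'] at h
    have h' := mul_le_mul_of_nonneg_left h hx.le
    have : x * (r / x - 1) = r - x := by field_simp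
    linarith

theorem exp_neg_le_quadratic {y : ℝ} (hy : 0 ≤ y) : Real.exp (-y) ≤ 1 - y + y ^ 2 / 2 := by
  rw [Real.exp_neg]
  refine inv_le_of_inv_le₀ (by nlinarith [sq_nonneg (y - 1)]) ?_
  refine le_trans ?_ (Real.quadratic_le_exp_of_nonneg hy)
  rw [inv_le_iff_one_le_mul₀ (by nlinarith [sq_nonneg (y - 1)])]
  -- The product `(1 - y + y²/2)(1 + y + y²/2)` equals `1 + y⁴/4`.
  nlinarith [sq_nonneg (y ^ 2)]

/-- Strong convexity of the negative entropy along the segment from `q` to `p`. -/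
theorem entropy_segment_le {q p l y : ℝ} (hq : 0 ≤ q) (hp : 0 ≤ p) (hl0 : 0 < l) (hl1 : l < 1)
    (hy : 0 ≤ y) :
    (1 - l) * (q * Real.log (1 / q)) + l * (p * Real.log (1 / p)) +
        l * (y * (((1 - l) * q + l * p) - p) - ((1 - l) * q + l * p) * y ^ 2 / 2) ≤
      ((1 - l) * q + l * p) * Real.log (1 / ((1 - l) * q + l * p)) := by
  set r := (1 - l) * q + l * p with hr
  have h1l : 0 < 1 - l := sub_pos.mpr hl1
  have hr0 : 0 ≤ r := by positivity
  simp only [one_div, Real.log_inv]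
  rcases hr0.eq_or_lt with h0 | h0
  · have hq0 : q = 0 := by
      have : (1 - l) * q ≤ 0 := by nlinarith [mul_nonneg hl0.le hp]
      nlinarith
    have hp0 : p = 0 := by
      have : l * p ≤ 0 := by nlinarith [mul_nonneg h1l.le hq]
      nlinarith
    simp [hq0, hp0, ← h0]
  · have h1 := mul_log_add_sub_le hq h0
    -- For `p` the tangent is taken at `r e^{-y}` instead of `r`; this multiplicative-weights shift
    -- produces the gain `y (r - p) - r y² / 2`.
    have h2 := mul_log_add_sub_le hp (mul_pos h0 (Real.exp_pos (-y)))
    rw [Real.log_mul h0.ne' (Real.exp_pos _).ne', Real.log_exp] at h2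
    have h3 := mul_le_mul_of_nonneg_left (exp_neg_le_quadratic hy) h0.le
    have h4 : p * Real.log r + y * (r - p) - r * y ^ 2 / 2 + (p - r) ≤ p * Real.log p := by
      linarith
    have h5 := mul_le_mul_of_nonneg_left h1 h1l.le
    have h6 := mul_le_mul_of_nonneg_left h4 hl0.le
    have h7 : r * Real.log r = (1 - l) * (q * Real.log r) + l * (p * Real.log r) := by
      rw [hr]; ring
    have h8 : (1 - l) * (q - r) + l * (p - r) = 0 := by rw [hr]; ring
    linarith

section Algorithm

variable {State : Type u} [Fintype State] [DecidableEq State] {K H : ℕ} [NeZero K]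

omit [DecidableEq State] [NeZero K] in
theorem entropy_nonneg {q : State → ArmPair K → ℝ} (h0 : ∀ s a, 0 ≤ q s a)
    (h1 : ∀ s a, q s a ≤ 1) : 0 ≤ entropy q :=
  Finset.sum_nonneg fun s _ => Finset.sum_nonneg fun a _ => by
    rw [one_div, Real.log_inv]
    exact mul_nonneg (h0 s a) (neg_nonneg.mpr (Real.log_nonpos (h0 s a) (h1 s a)))

/-- Compare with the constant `1 / N` on the `N = S K²` active pairs. The total mass is `H`, so the
entropy is at most `H log N - H + 1`; then `H ≥ 1` and `N ≤ (SK)²` finish. -/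
theorem entropy_occ_le (M : LayeredMDP State K H) (π : HistPolicy State K) :
    entropy (M.occ π) ≤ 2 * H * Real.log (M.numStates * K) := by
  have hK : (1 : ℝ) ≤ K := Nat.one_le_cast.mpr (NeZero.pos K)
  have hS : (1 : ℝ) ≤ M.numStates := Nat.one_le_cast.mpr M.numStates_pos
  have hH : (1 : ℝ) ≤ H := Nat.one_le_cast.mpr M.horizon_pos
  set N : ℝ := M.numStates * K ^ 2 with hN
  have hN0 : 0 < N := by positivity
  have hzero : ∀ s, s ∉ M.activeStates → ∀ a, M.occ π s a = 0 := fun s hs a =>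
    (M.occ_isFlow π).eq_zero s a (by simpa [LayeredMDP.activeStates] using hs)
  have hrestrict : ∀ f : State → ArmPair K → ℝ, (∀ s, s ∉ M.activeStates → ∀ a, f s a = 0) →
      ∑ s ∈ M.activeStates, ∑ a, f s a = ∑ s, ∑ a, f s a := fun f hf =>
    Finset.sum_subset (Finset.subset_univ _) fun s _ hs =>
      Finset.sum_eq_zero fun a _ => hf s hs a
  have hterm : ∀ s a, M.occ π s a * Real.log (1 / M.occ π s a) ≤
      M.occ π s a * Real.log N - M.occ π s a + 1 / N := by
    intro s a
    have h := mul_log_add_sub_le (M.occ_nonneg π s a) (one_div_pos.mpr hN0)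
    rw [one_div, Real.log_inv] at h
    rw [one_div, Real.log_inv, one_div]
    linarith
  have hsum : entropy (M.occ π) ≤ H * Real.log N - H + 1 := by
    rw [entropy, ← hrestrict _ fun s hs a => by rw [hzero s hs a, zero_mul]]
    refine (Finset.sum_le_sum fun s _ => Finset.sum_le_sum fun a _ => hterm s a).trans_eq ?_
    simp only [Finset.sum_add_distrib, Finset.sum_sub_distrib, ← Finset.sum_mul]
    rw [hrestrict _ hzero, M.sum_occ]
    have : (M.activeStates.card : ℝ) = M.numStates := rfl
    simp only [Finset.sum_const, Finset.card_univ, Fintype.card_prod, Fintype.card_fin,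
      nsmul_eq_mul, Nat.cast_mul, this]
    have : (M.numStates : ℝ) * (K * K * (1 / N)) = 1 := by
      rw [hN]; field_simp
    rw [this]
  have hlog : Real.log N ≤ 2 * Real.log (M.numStates * K) := by
    rw [← Nat.cast_two, ← Real.log_pow]
    refine Real.log_le_log hN0 ?_
    rw [hN, mul_pow]
    gcongr
    exact le_self_pow₀ hS two_ne_zero
  have := mul_le_mul_of_nonneg_left hlog (zero_le_one.trans hH)
  linarith

omit [DecidableEq State] [NeZero K] in
/-- One step of follow the regularized leader: the minimum of the regularized cumulative loss grows
at least by the loss of the leader, up to a local-norm term. -/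
theorem regularized_min_step {Ω : Set (State → ArmPair K → ℝ)} (hconv : Convex ℝ Ω)
    (hnonneg : ∀ q ∈ Ω, ∀ s a, 0 ≤ q s a) {η : ℝ} (hη : 0 < η) {L x : State → ArmPair K → ℝ}
    (hx : ∀ s a, 0 ≤ x s a) {q p : State → ArmPair K → ℝ} (hq : q ∈ Ω) (hp : p ∈ Ω)
    (hmin : ∀ r ∈ Ω, (∑ s, ∑ a, q s a * L s a) - 1 / η * entropy q ≤
      (∑ s, ∑ a, r s a * L s a) - 1 / η * entropy r) :
    (∑ s, ∑ a, q s a * L s a) - 1 / η * entropy q + (∑ s, ∑ a, q s a * x s a) -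
        η / 2 * (∑ s, ∑ a, q s a * x s a ^ 2) ≤
      (∑ s, ∑ a, p s a * L s a) - 1 / η * entropy p + ∑ s, ∑ a, p s a * x s a := by
  -- Test minimality of `q` at `(1 - l) q + l p`, apply strong convexity with `y = η x`, and divide
  -- by `l`. Letting `l` tend to `0` afterwards avoids differentiating the entropy on the boundary,
  -- where its slope is infinite.
  have key : ∀ l : ℝ, 0 < l → l < 1 →
      (∑ s, ∑ a, q s a * L s a) - 1 / η * entropy q +
        (1 - l) * (∑ s, ∑ a, q s a * x s a) + l * (∑ s, ∑ a, p s a * x s a) -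
        η / 2 * ((1 - l) * (∑ s, ∑ a, q s a * x s a ^ 2) + l * ∑ s, ∑ a, p s a * x s a ^ 2) ≤
      (∑ s, ∑ a, p s a * L s a) - 1 / η * entropy p + ∑ s, ∑ a, p s a * x s a := by
    intro l hl0 hl1
    have hr : (1 - l) • q + l • p ∈ Ω :=
      hconv hq hp (sub_pos.mpr hl1).le hl0.le (by ring)
    have h1 := hmin _ hr
    have hent : (1 - l) * entropy q + l * entropy p + l * (∑ s, ∑ a,
        (η * x s a * (((1 - l) * q s a + l * p s a) - p s a) -
          ((1 - l) * q s a + l * p s a) * (η * x s a) ^ 2 / 2)) ≤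
        entropy ((1 - l) • q + l • p) := by
      simp only [entropy, Finset.mul_sum, ← Finset.sum_add_distrib]
      exact Finset.sum_le_sum fun s _ => Finset.sum_le_sum fun a _ =>
        entropy_segment_le (hnonneg q hq s a) (hnonneg p hp s a) hl0 hl1
          (mul_nonneg hη.le (hx s a))
    have hlin : ∑ s, ∑ a, ((1 - l) • q + l • p) s a * L s a =
        (1 - l) * (∑ s, ∑ a, q s a * L s a) + l * ∑ s, ∑ a, p s a * L s a := by
      simp only [Finset.mul_sum, ← Finset.sum_add_distrib, Pi.add_apply, Pi.smul_apply,
        smul_eq_mul]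
      exact Finset.sum_congr rfl fun s _ => Finset.sum_congr rfl fun a _ => by ring
    have hgain : ∑ s, ∑ a, (η * x s a * (((1 - l) * q s a + l * p s a) - p s a) -
          ((1 - l) * q s a + l * p s a) * (η * x s a) ^ 2 / 2) =
        η * ((1 - l) * (∑ s, ∑ a, q s a * x s a) + l * (∑ s, ∑ a, p s a * x s a) -
          (∑ s, ∑ a, p s a * x s a) -
          η / 2 * ((1 - l) * (∑ s, ∑ a, q s a * x s a ^ 2) +
            l * ∑ s, ∑ a, p s a * x s a ^ 2)) := by
      simp only [Finset.mul_sum, ← Finset.sum_add_distrib, ← Finset.sum_sub_distrib]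
      exact Finset.sum_congr rfl fun s _ => Finset.sum_congr rfl fun a _ => by ring
    rw [hgain] at hent
    rw [hlin] at h1
    have hent' := mul_le_mul_of_nonneg_left hent (one_div_pos.mpr hη).le
    set X := (1 - l) * (∑ s, ∑ a, q s a * x s a) + l * (∑ s, ∑ a, p s a * x s a) -
          (∑ s, ∑ a, p s a * x s a) -
          η / 2 * ((1 - l) * (∑ s, ∑ a, q s a * x s a ^ 2) +
            l * ∑ s, ∑ a, p s a * x s a ^ 2) with hX
    have hcancel : 1 / η * ((1 - l) * entropy q + l * entropy p + l * (η * X)) =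
        (1 - l) * (1 / η * entropy q) + l * (1 / η * entropy p) + l * X := by
      field_simp
    rw [hcancel] at hent'
    have hl : l * ((∑ s, ∑ a, q s a * L s a) - 1 / η * entropy q + X) ≤
        l * ((∑ s, ∑ a, p s a * L s a) - 1 / η * entropy p) := by linarith
    have := le_of_mul_le_mul_left hl hl0
    linarith
  have hlim : Filter.Tendsto (fun l : ℝ => (∑ s, ∑ a, q s a * L s a) - 1 / η * entropy q +
        (1 - l) * (∑ s, ∑ a, q s a * x s a) + l * (∑ s, ∑ a, p s a * x s a) -
        η / 2 * ((1 - l) * (∑ s, ∑ a, q s a * x s a ^ 2) + l * ∑ s, ∑ a, p s a * x s a ^ 2))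
      (nhdsWithin 0 (Set.Ioi 0)) (nhds ((∑ s, ∑ a, q s a * L s a) - 1 / η * entropy q +
        (1 - 0) * (∑ s, ∑ a, q s a * x s a) + 0 * (∑ s, ∑ a, p s a * x s a) -
        η / 2 * ((1 - 0) * (∑ s, ∑ a, q s a * x s a ^ 2) +
          0 * ∑ s, ∑ a, p s a * x s a ^ 2))) := by
    refine (Continuous.tendsto ?_ 0).mono_left nhdsWithin_le_nhds
    fun_prop
  have hle := le_of_tendsto hlim (Filter.eventually_of_mem
    (Ioo_mem_nhdsGT (zero_lt_one' ℝ)) fun l hl => key l hl.1 hl.2)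
  simpa using hle

theorem ftrlObjective_cons (M : LayeredMDP State K H) (γ : Set.Ioc (0 : ℝ) (1 / 2)) (η : ℝ)
    (c : Choices State K) (past : List (Episode State K)) (e : Episode State K)
    (q : State → ArmPair K → ℝ) :
    ftrlObjective M γ η c (e :: past) q = ftrlObjective M γ η c past q +
      ∑ s, ∑ a, q s a * lossHat M γ c past e s a := by
  simp only [ftrlObjective, cumLossHat, mul_add, Finset.sum_add_distrib]
  ring

variable {M : LayeredMDP State K H} {γ : Set.Ioc (0 : ℝ) (1 / 2)} {η : ℝ} {c : Choices State K}

theorem Choices.IsImplementation.ftrlObjective_step (hc : c.IsImplementation M γ η) (hη : 0 < η)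
    (past : List (Episode State K)) (e : Episode State K) :
    ftrlObjective M γ η c past (c.ftrlOcc past) +
        (∑ s, ∑ a, c.ftrlOcc past s a * lossHat M γ c past e s a) -
        η / 2 * (∑ s, ∑ a, c.ftrlOcc past s a * lossHat M γ c past e s a ^ 2) ≤
      ftrlObjective M γ η c (e :: past) (c.ftrlOcc (e :: past)) := by
  rw [ftrlObjective_cons]
  exact regularized_min_step LayeredMDP.occSet_convex
    (fun q hq => (LayeredMDP.isFlow_of_mem_occSet hq).nonneg) hη
    (lossHat_nonneg M γ c past e) (hc.ftrlOcc_mem past) (hc.ftrlOcc_mem _) (hc.ftrlOcc_min past)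

/-! ## Regret -/

theorem Choices.IsImplementation.stateMass_le (hc : c.IsImplementation M γ η)
    {q : State → ArmPair K → ℝ} (hq : q ∈ M.occSet) (s : State) :
    stateMass q s ≤ stateMass (M.occ (c.reachPolicy s).toHist) s := by
  rw [(LayeredMDP.isFlow_of_mem_occSet (hc.reachOcc_mem s)).occ_eq (hc.reachPolicy_induced s)]
  exact hc.reachOcc_max s q hq

/-- Unbiasedness is only available at active, reachable states; these are the only ones that an
occupancy measure charges. -/
theorem Choices.IsImplementation.active_and_reachable (hc : c.IsImplementation M γ η)
    {q : State → ArmPair K → ℝ} (hq : q ∈ M.occSet) {s : State} {a : ArmPair K}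
    (h : q s a ≠ 0) :
    s ∈ M.activeStates ∧ 0 < stateMass (M.occ (c.reachPolicy s).toHist) s := by
  have hflow := LayeredMDP.isFlow_of_mem_occSet hq
  refine ⟨?_, ?_⟩
  · by_contra hs
    exact h (hflow.eq_zero s a (by simpa [LayeredMDP.activeStates] using hs))
  · exact ((hflow.nonneg s a).lt_of_ne' h).trans_le
      ((LayeredMDP.le_stateMass hflow.nonneg s a).trans (hc.stateMass_le hq s))

theorem Choices.IsImplementation.expect_inner_lossHat (hc : c.IsImplementation M γ η)
    {q : State → ArmPair K → ℝ} (hq : q ∈ M.occSet) (p : Preference State K)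
    (past : List (Episode State K)) :
    expect (episodeLaw M γ c p past)
        (fun e => ∑ s, ∑ a, q s a * lossHat M γ c past e s a) =
      ∑ s, ∑ a, q s a * p.loss s a := by
  have hfin := episodeLaw_support_finite M γ c p past
  rw [expect_finset_sum hfin]
  refine Finset.sum_congr rfl fun s _ => ?_
  rw [expect_finset_sum hfin]
  refine Finset.sum_congr rfl fun a _ => ?_
  rw [expect_const_mul hfin]
  by_cases h : q s a = 0
  · simp [h]
  · obtain ⟨hs, hm⟩ := hc.active_and_reachable hq h
    rw [expect_lossHat M γ c p past hs hm]

/-- Each active state contributes at most `q(s) · SK / (γ m_s) ≤ SK / γ`, by maximality of `m_s`;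
there are `S` of them. -/
theorem Choices.IsImplementation.expect_inner_lossHat_sq_le (hc : c.IsImplementation M γ η)
    {q : State → ArmPair K → ℝ} (hq : q ∈ M.occSet) (p : Preference State K)
    (past : List (Episode State K)) :
    expect (episodeLaw M γ c p past)
        (fun e => ∑ s, ∑ a, q s a * lossHat M γ c past e s a ^ 2) ≤
      (M.numStates : ℝ) ^ 2 * K / γ := by
  have hfin := episodeLaw_support_finite M γ c p past
  have hγ : (0 : ℝ) < γ := γ.2.1
  have hflow := LayeredMDP.isFlow_of_mem_occSet hq
  rw [expect_finset_sum hfin]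
  have hstate : ∀ s, expect (episodeLaw M γ c p past)
      (fun e => ∑ a, q s a * lossHat M γ c past e s a ^ 2) ≤
      if s ∈ M.activeStates then (M.numStates : ℝ) * K / γ else 0 := by
    intro s
    rw [expect_finset_sum hfin]
    simp only [expect_const_mul hfin]
    split_ifs with hs
    · set m := stateMass (M.occ (c.reachPolicy s).toHist) s with hmdef
      rcases (LayeredMDP.stateMass_nonneg (M.occ_nonneg (c.reachPolicy s).toHist) s).eq_or_lt
        with h0 | hm
      · have hz : ∀ a, q s a = 0 := fun a => by
          by_contra h
          exact (hc.active_and_reachable hq h).2.ne h0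
        simp only [hz, zero_mul, Finset.sum_const_zero]
        positivity
      · calc ∑ a, q s a * expect (episodeLaw M γ c p past)
              (fun e => lossHat M γ c past e s a ^ 2)
            ≤ ∑ a, q s a * (M.numStates * K / ((γ : ℝ) * m)) :=
              Finset.sum_le_sum fun a _ => mul_le_mul_of_nonneg_left
                (expect_lossHat_sq_le M γ c p past hs hm a) (hflow.nonneg s a)
          _ = stateMass q s * (M.numStates * K / ((γ : ℝ) * m)) := by
              rw [← Finset.sum_mul, stateMass]
          _ ≤ m * (M.numStates * K / ((γ : ℝ) * m)) :=
              mul_le_mul_of_nonneg_right (hc.stateMass_le hq s)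
                (div_nonneg (by positivity) (mul_pos hγ hm).le)
          _ = M.numStates * K / γ := by
              have : m ≠ 0 := hm.ne'
              field_simp
    · refine (Finset.sum_eq_zero fun a _ => ?_).le
      rw [hflow.eq_zero s a (by simpa [LayeredMDP.activeStates] using hs), zero_mul]
  refine (Finset.sum_le_sum fun s _ => hstate s).trans_eq ?_
  rw [Finset.sum_ite_mem, Finset.univ_inter, Finset.sum_const, nsmul_eq_mul]
  change (M.numStates : ℝ) * _ = _
  ring

/-- With probability `1 - γ` the leader's policy is executed, and its occupancy measure is the
leader itself; an exploration episode costs at most `H`. -/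
theorem Choices.IsImplementation.expect_value_executed_le (hc : c.IsImplementation M γ η)
    (p : Preference State K) (past : List (Episode State K)) :
    expect (episodeLaw M γ c p past)
        (fun e => M.value (c.executed past e.draw) M.init p.loss) ≤
      (∑ s, ∑ a, c.ftrlOcc past s a * p.loss s a) + γ * H := by
  have hγ : (0 : ℝ) < γ := γ.2.1
  have hS : (0 : ℝ) < M.numStates := Nat.cast_pos.mpr M.numStates_pos
  have hdraw : expect (episodeLaw M γ c p past)
      (fun e => M.value (c.executed past e.draw) M.init p.loss) =
      expect (drawLaw M γ) fun d => M.value (c.executed past d) M.init p.loss := by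
    rw [expect_episodeLaw]
    refine expect_congr fun d _ => ?_
    rw [expect_congr fun path _ => expect_const (p.feedbackLaw_support_finite path)
        (M.value (c.executed past d) M.init p.loss),
      expect_const (M.pathLaw_support_finite _ _)]
  have hnone : M.value (c.executed past none) M.init p.loss =
      ∑ s, ∑ a, c.ftrlOcc past s a * p.loss s a := by
    rw [M.value_eq_sum_occ, Choices.executed,
      (LayeredMDP.isFlow_of_mem_occSet (hc.ftrlOcc_mem past)).occ_eq (hc.ftrlPolicy_induced past)]
  have hsome : 1 / (M.numStates : ℝ) * ∑ s ∈ M.activeStates,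
      M.value (c.executed past (some s)) M.init p.loss ≤ H := by
    rw [one_div, inv_mul_le_iff₀ hS]
    refine (Finset.sum_le_sum fun s _ => M.value_le _ p.loss_le_one).trans_eq ?_
    rw [Finset.sum_const, nsmul_eq_mul]
    rfl
  have hpos := M.value_nonneg (c.executed past none) p.loss_nonneg
  rw [hdraw, expect_drawLaw, ← hnone]
  have h1 := mul_le_mul_of_nonneg_left hsome hγ.le
  have h2 := mul_nonneg hγ.le hpos
  linarith

/-! ### Telescoping over a run. -/

theorem runLaw_support_finite (M : LayeredMDP State K H) (γ : Set.Ioc (0 : ℝ) (1 / 2))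
    (c : Choices State K) (pref : ℕ → Preference State K) (n : ℕ) :
    (runLaw M γ c pref n).support.Finite := by
  induction n with
  | zero => simp [runLaw]
  | succ n ih =>
    exact finite_support_bind ih fun past =>
      finite_support_map (episodeLaw_support_finite M γ c _ past) _

theorem length_of_mem_runLaw {pref : ℕ → Preference State K} {n : ℕ} :
    ∀ run ∈ (runLaw M γ c pref n).support, run.length = n := by
  induction n with
  | zero => intro run h; simp [runLaw] at h; simp [h]
  | succ n ih =>
    intro run h
    simp only [runLaw, PMF.mem_support_bind_iff, PMF.mem_support_map_iff] at h
    obtain ⟨past, hpast, e, _, rfl⟩ := h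
    simp [ih past hpast]

theorem expect_runLaw_succ (M : LayeredMDP State K H) (γ : Set.Ioc (0 : ℝ) (1 / 2))
    (c : Choices State K) (pref : ℕ → Preference State K) (n : ℕ)
    (f : List (Episode State K) → ℝ) :
    expect (runLaw M γ c pref (n + 1)) f = expect (runLaw M γ c pref n) fun past =>
      expect (episodeLaw M γ c (pref n) past) fun e => f (e :: past) := by
  rw [runLaw, expect_bind (runLaw_support_finite M γ c pref n) fun past =>
    finite_support_map (episodeLaw_support_finite M γ c _ past) _]
  exact expect_congr fun past _ => expect_map (episodeLaw_support_finite M γ c _ past) _ _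

theorem Choices.IsImplementation.expect_inner_cumLossHat (hc : c.IsImplementation M γ η)
    {q : State → ArmPair K → ℝ} (hq : q ∈ M.occSet) (pref : ℕ → Preference State K) (n : ℕ) :
    expect (runLaw M γ c pref n) (fun run => ∑ s, ∑ a, q s a * cumLossHat M γ c run s a) =
      ∑ t ∈ Finset.range n, ∑ s, ∑ a, q s a * (pref t).loss s a := by
  induction n with
  | zero => simp [runLaw, expect_pure, cumLossHat]
  | succ n ih =>
    have hfin := runLaw_support_finite M γ c pref n
    rw [expect_runLaw_succ, Finset.sum_range_succ, ← ih,
      ← expect_const hfin (∑ s, ∑ a, q s a * (pref n).loss s a), ← expect_add hfin]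
    refine expect_congr fun past _ => ?_
    have hfin' := episodeLaw_support_finite M γ c (pref n) past
    simp only [cumLossHat, mul_add, Finset.sum_add_distrib]
    rw [expect_add hfin', expect_const hfin', hc.expect_inner_lossHat hq]

/-- The potential has bounded conditional drift: given the past the leader is fixed, so its
estimated loss is unbiased and cancels the growth of the minimum up to exploration cost and local
norm. -/
theorem Choices.IsImplementation.expect_potential_le (hc : c.IsImplementation M γ η) (hη : 0 < η)
    (pref : ℕ → Preference State K) (n : ℕ) :
    expect (runLaw M γ c pref n) (fun run =>
        learnerValue M c pref run - ftrlObjective M γ η c run (c.ftrlOcc run)) ≤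
      1 / η * entropy (c.ftrlOcc []) +
        n * (γ * H + η / 2 * ((M.numStates : ℝ) ^ 2 * K / γ)) := by
  induction n with
  | zero => simp [runLaw, expect_pure, learnerValue, ftrlObjective, cumLossHat]
  | succ n ih =>
    have hfin := runLaw_support_finite M γ c pref n
    have hstep : ∀ past ∈ (runLaw M γ c pref n).support,
        expect (episodeLaw M γ c (pref n) past) (fun e => learnerValue M c pref (e :: past) -
          ftrlObjective M γ η c (e :: past) (c.ftrlOcc (e :: past))) ≤
        (learnerValue M c pref past - ftrlObjective M γ η c past (c.ftrlOcc past)) +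
          (γ * H + η / 2 * ((M.numStates : ℝ) ^ 2 * K / γ)) := by
      intro past hpast
      have hfin' := episodeLaw_support_finite M γ c (pref n) past
      have h1 := hc.expect_value_executed_le (pref n) past
      have h2 := hc.expect_inner_lossHat (hc.ftrlOcc_mem past) (pref n) past
      have h3 := mul_le_mul_of_nonneg_left
        (hc.expect_inner_lossHat_sq_le (hc.ftrlOcc_mem past) (pref n) past) (half_pos hη).le
      have h4 := expect_mono hfin' fun e _ => hc.ftrlObjective_step hη past e
      rw [expect_sub hfin', expect_add hfin', expect_const hfin', expect_const_mul hfin', h2] at h4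
      simp only [learnerValue, length_of_mem_runLaw past hpast]
      rw [expect_sub hfin', expect_add hfin', expect_const hfin']
      linarith
    rw [expect_runLaw_succ]
    refine (expect_mono hfin hstep).trans ?_
    rw [expect_add hfin, expect_const hfin]
    push_cast
    linarith

/-- The final minimum is at most the objective at the comparator, whose entropy is nonnegative and
can be dropped; the comparator is fixed in advance, so its estimated losses are unbiased. -/
theorem Choices.IsImplementation.expect_learnerValue_le (hc : c.IsImplementation M γ η)
    (hη : 0 < η) (pref : ℕ → Preference State K) (n : ℕ) (π : Policy State K) :
    expect (runLaw M γ c pref n) (learnerValue M c pref) ≤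
      (∑ t ∈ Finset.range n, M.value π.toHist M.init (pref t).loss) +
        (2 * H * Real.log (M.numStates * K) / η +
          n * (γ * H + η / 2 * ((M.numStates : ℝ) ^ 2 * K / γ))) := by
  have hfin := runLaw_support_finite M γ c pref n
  have hπ : M.occ π.toHist ∈ M.occSet := ⟨π, rfl⟩
  have h1 := hc.expect_potential_le hη pref n
  have h2 : expect (runLaw M γ c pref n)
      (fun run => ftrlObjective M γ η c run (c.ftrlOcc run)) ≤
      ∑ t ∈ Finset.range n, M.value π.toHist M.init (pref t).loss := by
    simp only [M.value_eq_sum_occ]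
    rw [← hc.expect_inner_cumLossHat hπ]
    refine expect_mono hfin fun run _ => (hc.ftrlOcc_min run _ hπ).trans ?_
    have := mul_nonneg (one_div_pos.mpr hη).le
      (entropy_nonneg (M.occ_nonneg π.toHist) (M.occ_le_one π.toHist))
    rw [ftrlObjective]
    linarith
  have h3 : 1 / η * entropy (c.ftrlOcc []) ≤ 2 * H * Real.log (M.numStates * K) / η := by
    obtain ⟨ρ, hρ⟩ := hc.ftrlOcc_mem []
    rw [hρ, one_div, inv_mul_eq_div]
    exact div_le_div_of_nonneg_right (entropy_occ_le M _) hη.le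
  rw [expect_sub hfin] at h1
  linarith

/-! ### Reduction to a fixed comparator, and trivial regret bounds. -/

theorem learnerValue_le (M : LayeredMDP State K H) (c : Choices State K)
    (pref : ℕ → Preference State K) (run : List (Episode State K)) :
    learnerValue M c pref run ≤ run.length * H := by
  induction run with
  | nil => simp [learnerValue]
  | cons e past ih =>
    have := M.value_le (c.executed past e.draw) (pref past.length).loss_le_one
    rw [learnerValue, List.length_cons]
    push_cast
    linarith

theorem expectedRegret_le_of_forall (M : LayeredMDP State K H) (γ : Set.Ioc (0 : ℝ) (1 / 2))
    (c : Choices State K) (pref : ℕ → Preference State K) (T : ℕ) {B : ℝ}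
    (h : ∀ π : Policy State K, expect (runLaw M γ c pref T) (learnerValue M c pref) ≤
      (∑ t ∈ Finset.range T, M.value π.toHist M.init (pref t).loss) + B) :
    expectedRegret M γ c pref T ≤ B := by
  have hfin := runLaw_support_finite M γ c pref T
  change expect _ (fun run => learnerValue M c pref run -
    ⨅ π : Policy State K, ∑ t ∈ Finset.range T, M.value π.toHist M.init (pref t).loss) ≤ B
  rw [expect_sub hfin, expect_const hfin, sub_le_comm]
  have : Nonempty (Policy State K) := ⟨fun _ => PMF.pure (0, 0)⟩
  exact le_ciInf fun π => sub_le_iff_le_add.mpr (h π)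

theorem expectedRegret_le_mul (M : LayeredMDP State K H) (γ : Set.Ioc (0 : ℝ) (1 / 2))
    (c : Choices State K) (pref : ℕ → Preference State K) (T : ℕ) :
    expectedRegret M γ c pref T ≤ H * T := by
  have hfin := runLaw_support_finite M γ c pref T
  refine expectedRegret_le_of_forall M γ c pref T fun π => ?_
  have h1 : expect (runLaw M γ c pref T) (learnerValue M c pref) ≤ T * H := by
    rw [← expect_const hfin (T * H : ℝ)]
    refine expect_mono hfin fun run hrun => ?_
    have := learnerValue_le M c pref run
    rwa [length_of_mem_runLaw run hrun] at this
  have h2 : 0 ≤ ∑ t ∈ Finset.range T, M.value π.toHist M.init (pref t).loss :=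
    Finset.sum_nonneg fun t _ => M.value_nonneg _ (pref t).loss_nonneg
  linarith

omit [Fintype State] [DecidableEq State] [NeZero K] in
theorem histPolicy_subsingleton (hK : K = 1) : Subsingleton (HistPolicy State K) := by
  subst hK
  refine ⟨fun π ρ => ?_⟩
  funext past s
  ext a
  have h : ∀ p : PMF (ArmPair 1), p a = 1 := fun p => by
    have := p.tsum_coe
    rwa [tsum_fintype, Fintype.sum_subsingleton _ a] at this
  rw [h, h]

/-- Needed when `SK = 1`: the claimed rate is then zero because its logarithm vanishes, but there is
only one policy. -/
theorem expectedRegret_nonpos_of_one_arm (hK : K = 1) (M : LayeredMDP State K H)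
    (γ : Set.Ioc (0 : ℝ) (1 / 2)) (c : Choices State K) (pref : ℕ → Preference State K) (T : ℕ) :
    expectedRegret M γ c pref T ≤ 0 := by
  have := histPolicy_subsingleton (State := State) hK
  have hfin := runLaw_support_finite M γ c pref T
  refine expectedRegret_le_of_forall M γ c pref T fun π => ?_
  have h : ∀ run : List (Episode State K), learnerValue M c pref run =
      ∑ t ∈ Finset.range run.length, M.value π.toHist M.init (pref t).loss := by
    intro run
    induction run with
    | nil => simp [learnerValue]
    | cons e past ih =>
      rw [learnerValue, ih, List.length_cons, Finset.sum_range_succ,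
        Subsingleton.elim (c.executed past e.draw) π.toHist]
  rw [expect_congr fun run hrun => (h run).trans (by rw [length_of_mem_runLaw run hrun]),
    expect_const hfin, add_zero]

end Algorithm

/-- The rate `(H² S² K)^{1/3} T^{2/3} L^{1/3}` as a multiple of the trivial bound `H T`. -/
theorem regret_rate_eq {h s k t l : ℝ} (hh : 0 < h) (hk : 0 ≤ k) (ht : 0 < t)
    (hl : 0 ≤ l) :
    (h ^ 2 * s ^ 2 * k) ^ (1 / 3 : ℝ) * t ^ (2 / 3 : ℝ) * l ^ (1 / 3 : ℝ) =
      (s ^ 2 * k * l / (h * t)) ^ (1 / 3 : ℝ) * (h * t) := by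
  have h1 : t ^ (2 / 3 : ℝ) = (t ^ 2) ^ (1 / 3 : ℝ) := by
    rw [← Real.rpow_natCast, ← Real.rpow_mul ht.le]
    norm_num
  have h2 : h * t = ((h * t) ^ 3) ^ (1 / 3 : ℝ) := by
    rw [← Real.rpow_natCast, ← Real.rpow_mul (by positivity)]
    norm_num
  rw [h1, ← Real.mul_rpow (by positivity) (by positivity),
    ← Real.mul_rpow (by positivity) (by positivity)]
  -- Only the outer factor `h * t` becomes a cube root; the one in the denominator stays.
  conv_rhs => arg 2; rw [h2]
  rw [← Real.mul_rpow (by positivity) (by positivity)]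
  congr 1
  field_simp

end PbMDP

/-! ### Tuning the exploration and learning rates. -/

theorem theorem3 :
    ∃ C : ℝ, 0 < C ∧
      ∀ (H S K T : ℕ) [NeZero K],
        8 * (S : ℝ) ^ 2 * (K : ℝ) * Real.log ((S : ℝ) * (K : ℝ)) / (H : ℝ) ^ 2 ≤ (T : ℝ) →
        ∃ (γ : Set.Ioc (0 : ℝ) (1 / 2)) (η : ℝ), 0 < η ∧
          ∀ (State : Type u) [Fintype State] [DecidableEq State]
            (M : PbMDP.LayeredMDP State K H), M.numStates = S →
          ∀ c : PbMDP.Choices State K, c.IsImplementation M γ η →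
          ∀ pref : ℕ → PbMDP.Preference State K,
            PbMDP.expectedRegret M γ c pref T ≤
              C * ((H : ℝ) ^ 2 * (S : ℝ) ^ 2 * (K : ℝ)) ^ (1 / 3 : ℝ) * (T : ℝ) ^ (2 / 3 : ℝ) *
                (Real.log ((S : ℝ) * (K : ℝ))) ^ (1 / 3 : ℝ) := by
  -- The constant counts the entropy, exploration and variance terms, each of which will equal `x H
  -- T`.
  refine ⟨3, by norm_num, fun H S K T _ _ => ?_⟩
  have hL : 0 ≤ Real.log ((S : ℝ) * K) := by
    rw [← Nat.cast_mul]
    exact Real.log_natCast_nonneg _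
  have hK : (0 : ℝ) < K := Nat.cast_pos.mpr (NeZero.pos K)
  have hrate : 0 ≤ 3 * ((H : ℝ) ^ 2 * (S : ℝ) ^ 2 * (K : ℝ)) ^ (1 / 3 : ℝ) *
      (T : ℝ) ^ (2 / 3 : ℝ) * (Real.log ((S : ℝ) * (K : ℝ))) ^ (1 / 3 : ℝ) := by positivity
  rcases Nat.eq_zero_or_pos T with rfl | hT
  · refine ⟨⟨1 / 2, by norm_num⟩, 1, one_pos, fun State _ _ M _ c _ pref => ?_⟩
    refine (PbMDP.expectedRegret_le_mul M _ c pref 0).trans ?_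
    simp
  rcases Nat.eq_zero_or_pos H with rfl | hH
  · exact ⟨⟨1 / 2, by norm_num⟩, 1, one_pos, fun State _ _ M _ =>
      absurd M.horizon_pos (lt_irrefl 0)⟩
  rcases Nat.eq_zero_or_pos S with rfl | hS
  · exact ⟨⟨1 / 2, by norm_num⟩, 1, one_pos, fun State _ _ M hM =>
      absurd hM M.numStates_pos.ne'⟩
  rcases hL.eq_or_lt with hL0 | hL0
  · refine ⟨⟨1 / 2, by norm_num⟩, 1, one_pos, fun State _ _ M _ c _ pref => ?_⟩
    refine (PbMDP.expectedRegret_nonpos_of_one_arm ?_ M _ c pref T).trans hrate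
    by_contra hK1
    have h2 : 1 < S * K := lt_of_lt_of_le
      (lt_of_le_of_ne (NeZero.one_le) (Ne.symm hK1)) (Nat.le_mul_of_pos_left K hS)
    have h3 : (1 : ℝ) < (S : ℝ) * K := by exact_mod_cast h2
    exact (Real.log_pos h3).ne hL0
  have hT' : (0 : ℝ) < T := Nat.cast_pos.mpr hT
  have hH' : (0 : ℝ) < H := Nat.cast_pos.mpr hH
  have hS' : (0 : ℝ) < S := Nat.cast_pos.mpr hS
  set L := Real.log ((S : ℝ) * K) with hLdef
  -- The claimed rate is `x H T`, and `x³ H T = S² K L`.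
  set x := ((S : ℝ) ^ 2 * K * L / (H * T)) ^ (1 / 3 : ℝ) with hx
  have hx0 : 0 < x := by positivity
  have hbound : 3 * ((H : ℝ) ^ 2 * (S : ℝ) ^ 2 * (K : ℝ)) ^ (1 / 3 : ℝ) *
      (T : ℝ) ^ (2 / 3 : ℝ) * L ^ (1 / 3 : ℝ) = 3 * (x * (H * T)) := by
    rw [hx, ← PbMDP.regret_rate_eq hH' hK.le hT' hL]
    ring
  rw [hbound]
  by_cases hx1 : x ≤ 1 / 2
  -- With `γ = x` exploration costs `x H T`; this `η` makes the entropy term `2 H L / η` equal to `x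
  -- H T`, and the variance term becomes `S² K L / x²`, the same by the choice of `x`.
  · refine ⟨⟨x, hx0, hx1⟩, 2 * L / (T * x), by positivity, fun State _ _ M hM c hc pref => ?_⟩
    refine PbMDP.expectedRegret_le_of_forall M _ c pref T fun π => ?_
    refine (hc.expect_learnerValue_le (by positivity) pref T π).trans ?_
    rw [hM, ← hLdef]
    have hcube : x ^ 3 * (H * T) = (S : ℝ) ^ 2 * K * L := by
      rw [hx, ← Real.rpow_natCast, ← Real.rpow_mul (by positivity)]
      norm_num
      field_simp
    have h1 : 2 * H * L / (2 * L / (T * x)) = x * (H * T) := by field_simp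
    have h2 : T * (x * H + 2 * L / (T * x) / 2 * ((S : ℝ) ^ 2 * K / x)) = 2 * (x * (H * T)) := by
      have : T * (x * H + 2 * L / (T * x) / 2 * ((S : ℝ) ^ 2 * K / x)) =
          x * (H * T) + ((S : ℝ) ^ 2 * K * L) / x ^ 2 := by field_simp
      rw [this, ← hcube]
      field_simp
      ring
    have h3 : 2 * H * L / (2 * L / (T * x)) +
        T * (x * H + 2 * L / (T * x) / 2 * ((S : ℝ) ^ 2 * K / x)) = 3 * (x * (H * T)) := by
      rw [h1, h2]; ring
    exact add_le_add le_rfl h3.le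
  -- For `x > 1 / 2` the trivial bound `H T` is already below `2 x H T`.
  · refine ⟨⟨1 / 2, by norm_num⟩, 1, one_pos, fun State _ _ M _ c _ pref => ?_⟩
    refine (PbMDP.expectedRegret_le_mul M _ c pref T).trans ?_
    have hHT : (0 : ℝ) < H * T := by positivity
    push Not at hx1
    nlinarith
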